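/- **The process.** Let $n\ge 2$ and let $\beta^j_i(t)$ ($1\le i\le j\le n$, $t=1,2,\dots$) be independent fair coin tosses, $\mathbb P[\beta^j_i(t)=0]=\mathbb P[\beta^j_i(t)=1]=\tfrac12$. The Aztec diamond particle process $X^j(t)=(X^j_1(t),\dots,X^j_j(t))\in\mathbb Z^j$, $1\le j\le n$, $t=0,1,2,\dots$, is defined by $X^j_i(0)=i$ and, for $t\ge1$, $$X^j_i(t)=X^j_i(t-1)+\beta^j_i(t)-\mathbf 1\{X^j_i(t-1)+\beta^j_i(t)=X^{j-1}_i(t)+1\}+\mathbf 1\{X^j_i(t-1)+\beta^j_i(t)=X^{j-1}_{i-1}(t)\},$$ where the first indicator is present only if $i<j$ and the second only if $i>1$. **Notation.** Let $\delta_i(x)=\mathbf 1\{x=i\}$ and $\phi=\tfrac12(\delta_0+\delta_1)$ on $\mathbb Z$. For functions on $\mathbb Z$ let $(f*g)(x)=\sum_{s+t=x}f(s)g(t)$, let $\phi^{(0)}=\delta_0$, $\phi^{(t)}=\phi^{(t-1)}*\phi$, and let $\Delta f=(\delta_0-\delta_1)*f$ and $\Delta^{-1}f(x)=\sum_{y\le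 x}f(y)$. Let $W^{k+1,k}=\{(x,y)\in\mathbb Z^{k+1}\times\mathbb Z^k: x_1\le y_1<x_2\le\dots\le y_k<x_{k+1}\}$ and $h_k(y)=\prod_{1\le i<j\le k}(y_j-y_i)$. For $(x,y),(x',y')\in W^{k+1,k}$ and $t=0,1,\dots$ let $$q^k_t((x,y),(x',y'))=\det\begin{bmatrix}A&B\\ C&D\end{bmatrix},$$ a $(2k+1)\times(2k+1)$ determinant with blocks (row index $i$, column index $j$) $$A_{ij}=\phi^{(t)}(x'_j-x_i),\quad B_{ij}=\Delta^{-1}\phi^{(t)}(y'_j-x_i)-\mathbf 1\{j\ge i\},\quad C_{ij}=\Delta\phi^{(t)}(x'_j-y_i),\quad D_{ij}=\phi^{(t)}(y'_j-y_i),$$ where $A$ is $(k+1)\times(k+1)$, $B$ is $(k+1)\times k$, $C$ is $k\times(k+1)$ and $D$ is $k\times k$. Put $$q^{k,+}_t((x,y),(x',y'))=\frac{h_k(y')}{h_k(y)}\,q^k_t((x,y),(x',y')).$$ **Theorem.** Let $1\le k<n$ and $Z(t)=(X^{k+1}(t),X^k(t))$. Almost surely $Z(t)\in W^{k+1,k}$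 for all $t\ge0$, and $(Z(t))_{t\ge 0}$ is a Markov chain with $t$-step transition probabilities $q^{k,+}_t$. That is, for all $s,t\ge0$ and all $(x,y),(x',y')\in W^{k+1,k}$ with $\mathbb P[Z(s)=(x,y)]>0$, $$\mathbb P\big[Z(s+t)=(x',y')\,\big|\,Z(s)=(x,y)\big]=q^{k,+}_t((x,y),(x',y')),$$ and, more generally, for all $z_0,\dots,z_s,z'\in W^{k+1,k}$ with $\mathbb P[Z(0)=z_0,\dots,Z(s)=z_s]>0$, $$\mathbb P\big[Z(s+t)=z'\,\big|\,Z(0)=z_0,\dots,Z(s)=z_s\big]=q^{k,+}_t(z_s,z').$$ -/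

import Mathlib

open MeasureTheory ProbabilityTheory

noncomputable section

namespace AztecShuffle

/-- Particle dynamics driven by an array of coin values `b j i t` (line `j`, particle `i`, time `t`):
`lines b j t i` is the position at time `t` of particle `i` on line `j`. Lines and particles are
numbered from `1`; line `j` carries the particles `1 ≤ i ≤ j`, and only these values are
meaningful. For `1 ≤ i ≤ j` the step from `t` to `t + 1` reads

  `X^j_i(t+1) = X^j_i(t) + b^j_i(t+1)`
    `- 1{X^j_i(t) + b^j_i(t+1) = X^{j-1}_i(t+1) + 1}`        (only if `i < j`)
    `+ 1{X^j_i(t) + b^j_i(t+1) = X^{j-1}_{i-1}(t+1)}`        (only if `1 < i`). -/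
def lines (b : ℕ → ℕ → ℕ → ℤ) : ℕ → ℕ → ℕ → ℤ
  | 0, _, i => (i : ℤ)
  | _ + 1, 0, i => (i : ℤ)
  | j + 1, t + 1, i =>
      (lines b (j + 1) t i + b (j + 1) i (t + 1))
        - (if i < j + 1 ∧ lines b (j + 1) t i + b (j + 1) i (t + 1) = lines b j (t + 1) i + 1
            then 1 else 0)
        + (if 1 < i ∧ lines b (j + 1) t i + b (j + 1) i (t + 1) = lines b j (t + 1) (i - 1)
            then 1 else 0)

/-- Indices `(j, i, t)` of the coins used by the first `n` lines:
`1 ≤ i ≤ j ≤ n` and `t ≥ 1`. -/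
def CoinIndex (n : ℕ) : Type :=
  {p : ℕ × ℕ × ℕ // 1 ≤ p.2.1 ∧ p.2.1 ≤ p.1 ∧ p.1 ≤ n ∧ 1 ≤ p.2.2}

/-- The coins `β j i t`, `1 ≤ i ≤ j ≤ n`, `t ≥ 1`, are independent fair coin tosses with
values in `{0, 1}`. -/
structure IsFairCoins {Ω : Type*} [MeasurableSpace Ω] (μ : Measure Ω) (n : ℕ)
    (β : ℕ → ℕ → ℕ → Ω → ℤ) : Prop where
  measurable : ∀ p : CoinIndex n, Measurable (β p.1.1 p.1.2.1 p.1.2.2)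
  prob_zero : ∀ p : CoinIndex n, μ {ω | β p.1.1 p.1.2.1 p.1.2.2 ω = 0} = 1 / 2
  prob_one : ∀ p : CoinIndex n, μ {ω | β p.1.1 p.1.2.1 p.1.2.2 ω = 1} = 1 / 2
  indep : iIndepFun (fun p : CoinIndex n => β p.1.1 p.1.2.1 p.1.2.2) μ

/-- The random position of particle `i` on line `j` at time `t`. -/
def X {Ω : Type*} (β : ℕ → ℕ → ℕ → Ω → ℤ) (j i t : ℕ) (ω : Ω) : ℤ :=
  lines (fun j i t => β j i t ω) j t i

/-- A configuration `(x, y)` of a line of `k + 1` particles and a line of `k` particles. -/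
abbrev State (k : ℕ) : Type := (Fin (k + 1) → ℤ) × (Fin k → ℤ)

/-- The pair `(X^{k+1}(t), X^k(t))`; entry `i : Fin _` is the particle number `i + 1`. -/
def pair {Ω : Type*} (β : ℕ → ℕ → ℕ → Ω → ℤ) (k t : ℕ) (ω : Ω) : State k :=
  (fun i => X β (k + 1) (i + 1) t ω, fun i => X β k (i + 1) t ω)

/-- `{(x, y) : x_1 ≤ y_1 < x_2 ≤ ⋯ ≤ y_k < x_{k+1}}`. -/
def W (k : ℕ) : Set (State k) :=
  {z | ∀ i : Fin k, z.1 i.castSucc ≤ z.2 i ∧ z.2 i < z.1 i.succ}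

/-- `delta i x` is `1` if `x = i`, and `0` otherwise. -/
def delta (i x : ℤ) : ℝ := if x = i then 1 else 0

/-- Convolution `(f * g)(x) = ∑_{s + t = x} f(s) g(t)` on `ℤ`. -/
def conv (f g : ℤ → ℝ) (x : ℤ) : ℝ := ∑' s : ℤ, f s * g (x - s)

/-- Convolution powers: `f^(0) = δ_0`, `f^(n) = f^(n-1) * f`. -/
def convPow (f : ℤ → ℝ) : ℕ → ℤ → ℝ
  | 0 => delta 0
  | n + 1 => conv (convPow f n) f

/-- Backward difference `Δ f = (δ_0 - δ_1) * f`. -/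
def bdiff (f : ℤ → ℝ) : ℤ → ℝ := conv (fun x => delta 0 x - delta 1 x) f

/-- Partial sums `(Δ⁻¹ f)(x) = ∑_{y ≤ x} f(y)`. -/
def psum (f : ℤ → ℝ) (x : ℤ) : ℝ := ∑' y : Set.Iic x, f y

/-- The fair coin-toss law `½ (δ_0 + δ_1)`. -/
def coin (x : ℤ) : ℝ := (1 / 2) * (delta 0 x + delta 1 x)

/-- The block determinant `q_t^k((x, y), (x', y'))`. -/
def q (k t : ℕ) (z z' : State k) : ℝ :=
  (Matrix.fromBlocks
    (Matrix.of fun (i j : Fin (k + 1)) => convPow coin t (z'.1 j - z.1 i))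
    (Matrix.of fun (i : Fin (k + 1)) (j : Fin k) =>
      psum (convPow coin t) (z'.2 j - z.1 i) - (if (i : ℕ) ≤ (j : ℕ) then 1 else 0))
    (Matrix.of fun (i : Fin k) (j : Fin (k + 1)) =>
      bdiff (convPow coin t) (z'.1 j - z.2 i))
    (Matrix.of fun (i j : Fin k) => convPow coin t (z'.2 j - z.2 i))).det

/-- `h_k(y) = ∏_{i < j} (y_j - y_i)`. -/
def h {k : ℕ} (y : Fin k → ℤ) : ℝ := ∏ i : Fin k, ∏ j ∈ Finset.Ioi i, ((y j : ℝ) - (y i : ℝ))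

/-- The Doob `h`-transform `q_t^{k,+} = (h_k(y') / h_k(y)) q_t^k`. -/
def qPlus (k t : ℕ) (z z' : State k) : ℝ := h z'.2 / h z.2 * q k t z z'

end AztecShuffle

end

/-!
The proof has a deterministic part, about the determinant `q`, and a probabilistic part, about the
one-step law of two adjacent lines.

*The determinant.* As a function of its starting point `z = (x, y)`, row by row, `q_t` is built from
convolution powers of the coin-toss law, so `q_{t+1}` is the average of `q_t` over free independent
coin-toss steps of all `2k + 1` particles. The rows are linked by `longRow_add_one`: moving
`x_i` from `a` to `a + 1` changes its row by the row of a particle of the shorter line at `a`. Hence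
blocking and pushing are row operations and do not change `q` (`q_interact`), while `q` vanishes
when two particles of the shorter line meet. So `q` satisfies the backward equation of the
block-and-push dynamics, the shorter line being killed at collisions (`q_succ`). At time `0` the
determinant is the indicator of `z = z'` on interlacing configurations (`q_zero`), because at the
first place where the two configurations differ the matrix becomes visibly singular. After the Doob
transform, `q^{k,+}_t` is the `t`-th power of a one-step kernel `pairStepProb` (`qPlus_succ`).

*The process.* Given the path of line `k`, line `k + 1` is updated by independent fresh coins
(`IsFairCoins.long_path_law`). If line `k` is a Markov chain whose kernel `lineStepProb` is the
`h`-transform of killed independent walks, then the pair `(X^{k+1}, X^k)` is a Markov chain with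
kernel `pairStepProb` (`IsFairCoins.pair_path_succ`). That every line is such a chain is proved by
induction on the line, by the Markov function argument: given the past of line `k + 1`, the law
of line `k` is proportional to `h_k` on the configurations interlacing with the current position
(`IsFairCoins.link_law`). This is preserved in time by the intertwining relation
`sum_link_mul_pairStepProb`, which rests on a local count (`sum_longStepProb`) and on the fact that
the sum of `h_k` over interlacing configurations is a multiple of `h_{k+1}` (`sum_interlacing_h`).
-/

noncomputable section

namespace AztecShuffle

/-! ### Convolution powers of the coin-toss law -/

theorem delta_apply (i x : ℤ) : delta i x = if x = i then 1 else 0 := rfl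

theorem bdiff_apply (f : ℤ → ℝ) (x : ℤ) : bdiff f x = f x - f (x - 1) := by
  unfold bdiff conv
  rw [tsum_eq_sum (s := {0, 1}) (fun s hs => by simp_all [delta_apply])]
  rw [Finset.sum_pair (by norm_num)]
  simp [delta_apply]
  ring

theorem convPow_coin_succ (t : ℕ) (x : ℤ) :
    convPow coin (t + 1) x = (1 / 2) * (convPow coin t x + convPow coin t (x - 1)) := by
  simp only [convPow, conv]
  rw [tsum_eq_sum (s := {x, x - 1}) (fun s hs => ?_)]
  · rw [Finset.sum_pair (by omega)]
    simp [coin, delta_apply]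
    ring
  · simp only [Finset.mem_insert, Finset.mem_singleton, not_or] at hs
    have h0 : x - s ≠ 0 := by omega
    have h1 : x - s ≠ 1 := by omega
    simp [coin, delta_apply, h0, h1]

theorem convPow_coin_of_neg (t : ℕ) {x : ℤ} (hx : x < 0) : convPow coin t x = 0 := by
  induction t generalizing x with
  | zero => simp [convPow, delta_apply, hx.ne]
  | succ t ih => rw [convPow_coin_succ, ih hx, ih (by omega)]; simp

theorem psum_eq_sum_Icc {f : ℤ → ℝ} (hf : ∀ x < 0, f x = 0) (x : ℤ) :
    psum f x = ∑ y ∈ Finset.Icc 0 x, f y := by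
  unfold psum
  rw [tsum_subtype, tsum_eq_sum (s := Finset.Icc 0 x)]
  · refine Finset.sum_congr rfl fun y hy => ?_
    rw [Set.indicator_of_mem]
    exact (Finset.mem_Icc.1 hy).2
  · intro y hy
    by_cases hyx : y ≤ x
    · rw [Set.indicator_of_mem (by exact hyx)]
      exact hf y (by simp at hy; omega)
    · exact Set.indicator_of_notMem (by exact hyx) _

theorem psum_sub_psum_pred {f : ℤ → ℝ} (hf : ∀ x < 0, f x = 0) (x : ℤ) :
    psum f x - psum f (x - 1) = f x := by
  rw [psum_eq_sum_Icc hf, psum_eq_sum_Icc hf]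
  rcases lt_or_ge x 0 with hx | hx
  · rw [Finset.Icc_eq_empty (by omega), Finset.Icc_eq_empty (by omega), hf x hx]; simp
  · have : Finset.Icc 0 x = insert x (Finset.Icc 0 (x - 1)) := by
      ext a; simp; omega
    rw [this, Finset.sum_insert (by simp)]; ring

theorem psum_convPow_coin_succ (t : ℕ) (x : ℤ) :
    psum (convPow coin (t + 1)) x =
      (1 / 2) * (psum (convPow coin t) x + psum (convPow coin t) (x - 1)) := by
  have hneg : ∀ t, ∀ y < 0, convPow coin t y = 0 := fun t _ hy => convPow_coin_of_neg t hy
  rcases lt_or_ge x 0 with hx | hx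
  · simp only [psum_eq_sum_Icc (hneg _)]
    rw [Finset.Icc_eq_empty (by omega), Finset.Icc_eq_empty (by omega)]; simp
  · induction x, hx using Int.leInduction with
    | base =>
      simp only [psum_eq_sum_Icc (hneg _)]
      simp [convPow_coin_succ, hneg t (-1)]
    | succ x hx ih =>
      have h1 := psum_sub_psum_pred (hneg (t + 1)) (x + 1)
      have h2 := psum_sub_psum_pred (hneg t) (x + 1)
      have h3 := psum_sub_psum_pred (hneg t) x
      have h4 := convPow_coin_succ t (x + 1)
      simp only [add_sub_cancel_right] at *
      linarith

theorem psum_delta_zero (x : ℤ) : psum (delta 0) x = if 0 ≤ x then 1 else 0 := by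
  rw [psum_eq_sum_Icc (fun y hy => by simp [delta_apply, hy.ne])]
  simp [delta_apply]

/-! ### The backward equation for `q` -/

/-- The row of the block matrix of `q` that belongs to particle `i` of the longer line when this
particle is at `a`; the target configuration is `w`. -/
def longRow (k t : ℕ) (w : State k) (i : Fin (k + 1)) (a : ℤ) : Fin (k + 1) ⊕ Fin k → ℝ :=
  Sum.elim (fun j => convPow coin t (w.1 j - a))
    (fun j => psum (convPow coin t) (w.2 j - a) - (if (i : ℕ) ≤ (j : ℕ) then 1 else 0))

/-- The row of the block matrix of `q` that belongs to a particle of the shorter line at `b`. -/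
def shortRow (k t : ℕ) (w : State k) (b : ℤ) : Fin (k + 1) ⊕ Fin k → ℝ :=
  Sum.elim (fun j => bdiff (convPow coin t) (w.1 j - b)) (fun j => convPow coin t (w.2 j - b))

theorem q_eq_det_rows (k t : ℕ) (z w : State k) :
    q k t z w = (Matrix.of (Sum.elim (fun i => longRow k t w i (z.1 i))
      (fun i => shortRow k t w (z.2 i)))).det := by
  unfold q
  congr 1

/-- The relation `ΔΔ⁻¹ = 1` between the blocks: it is what makes `q` compatible with blocking
and pushing. -/
theorem longRow_add_one (k t : ℕ) (w : State k) (i : Fin (k + 1)) (a : ℤ) :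
    longRow k t w i (a + 1) = longRow k t w i a - shortRow k t w a := by
  ext (j | j)
  · simp only [longRow, shortRow, Sum.elim_inl, Pi.sub_apply, bdiff_apply]
    rw [show w.1 j - (a + 1) = w.1 j - a - 1 by ring]; ring
  · simp only [longRow, shortRow, Sum.elim_inr, Pi.sub_apply]
    have := psum_sub_psum_pred (fun _ hy => convPow_coin_of_neg t hy) (w.2 j - a)
    rw [show w.2 j - (a + 1) = w.2 j - a - 1 by ring]; linarith

theorem longRow_succ (k t : ℕ) (w : State k) (i : Fin (k + 1)) (a : ℤ) :
    longRow k (t + 1) w i a = ∑ e ∈ ({0, 1} : Finset ℤ), (1 / 2 : ℝ) • longRow k t w i (a + e) := by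
  rw [Finset.sum_pair (by norm_num)]
  ext (j | j) <;> simp only [longRow, Sum.elim_inl, Sum.elim_inr, Pi.add_apply, Pi.smul_apply,
    convPow_coin_succ, psum_convPow_coin_succ, add_zero, smul_eq_mul, ← sub_sub] <;> ring

theorem shortRow_succ (k t : ℕ) (w : State k) (b : ℤ) :
    shortRow k (t + 1) w b = ∑ e ∈ ({0, 1} : Finset ℤ), (1 / 2 : ℝ) • shortRow k t w (b + e) := by
  rw [Finset.sum_pair (by norm_num)]
  ext (j | j) <;> simp only [shortRow, Sum.elim_inl, Sum.elim_inr, Pi.add_apply, Pi.smul_apply,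
    bdiff_apply, convPow_coin_succ, add_zero, smul_eq_mul, ← sub_sub]
  · rw [sub_right_comm (w.1 j - b) 1 1]; ring
  · ring

/-- All outcomes of one round of coin tosses for a line of `k + 1` and a line of `k` particles. -/
def tosses (k : ℕ) : Finset (Fin (k + 1) ⊕ Fin k → ℤ) := Fintype.piFinset fun _ => {0, 1}

theorem mem_tosses {k : ℕ} {c : Fin (k + 1) ⊕ Fin k → ℤ} :
    c ∈ tosses k ↔ ∀ r, c r = 0 ∨ c r = 1 := by
  simp [tosses, Fintype.mem_piFinset]

/-- `q_{t+1}` is the average of `q_t` over free independent coin-toss steps. -/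
theorem q_succ_eq_sum_free (k t : ℕ) (z w : State k) :
    q k (t + 1) z w = ∑ c ∈ tosses k, (1 / 2 : ℝ) ^ (2 * k + 1) *
      q k t (fun i => z.1 i + c (.inl i), fun i => z.2 i + c (.inr i)) w := by
  set R : Fin (k + 1) ⊕ Fin k → ℤ → Fin (k + 1) ⊕ Fin k → ℝ := fun r e =>
    Sum.elim (fun i => longRow k t w i (z.1 i + e)) (fun i => shortRow k t w (z.2 i + e)) r with hR
  have hrow : Sum.elim (fun i => longRow k (t + 1) w i (z.1 i))
      (fun i => shortRow k (t + 1) w (z.2 i))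
      = fun r => ∑ e ∈ ({0, 1} : Finset ℤ), (1 / 2 : ℝ) • R r e := by
    funext r
    rcases r with i | i
    · exact longRow_succ k t w i (z.1 i)
    · exact shortRow_succ k t w (z.2 i)
  rw [q_eq_det_rows, hrow]
  have := (Matrix.detRowAlternating (R := ℝ)
    (n := Fin (k + 1) ⊕ Fin k)).toMultilinearMap.map_sum_finset
      (fun r e => (1 / 2 : ℝ) • R r e) (fun _ => ({0, 1} : Finset ℤ))
  refine this.trans (Finset.sum_congr rfl fun c _ => ?_)
  have h2 := (Matrix.detRowAlternating (R := ℝ)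
    (n := Fin (k + 1) ⊕ Fin k)).toMultilinearMap.map_smul_univ (fun _ => (1 / 2 : ℝ))
      (fun r => R r (c r))
  rw [h2, q_eq_det_rows]
  simp only [Finset.prod_const, Finset.card_univ, Fintype.card_sum, Fintype.card_fin, smul_eq_mul]
  congr 1
  · congr 1; omega
  · change Matrix.det _ = Matrix.det _
    congr 1
    ext (i | i) j <;> rfl

/-- The effect of the shorter line, at its new positions `y`, on particle `i` of the longer line
that attempts to go to `v`: it is blocked by particle `i` and pushed by particle `i - 1` of the
shorter line. -/
def interact {k : ℕ} (y : Fin k → ℤ) (i : Fin (k + 1)) (v : ℤ) : ℤ :=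
  v - (if ∃ m : Fin k, m.castSucc = i ∧ v = y m + 1 then 1 else 0)
    + (if ∃ m : Fin k, m.succ = i ∧ v = y m then 1 else 0)

theorem longRow_interact {k : ℕ} (t : ℕ) (w : State k) {y : Fin k → ℤ} (hy : StrictMono y)
    (i : Fin (k + 1)) (v : ℤ) : ∃ C : Fin k → ℝ,
      longRow k t w i (interact y i v) = longRow k t w i v + ∑ m, C m • shortRow k t w (y m) := by
  by_cases h1 : ∃ m : Fin k, m.castSucc = i ∧ v = y m + 1
  · by_cases h2 : ∃ m : Fin k, m.succ = i ∧ v = y m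
    -- Being blocked and pushed at once would violate the order of `y`.
    · exfalso
      obtain ⟨a, rfl, ha⟩ := h1
      obtain ⟨b, hb, hb'⟩ := h2
      have : b < a := by
        have := congrArg Fin.val hb
        simp at this
        exact Fin.lt_def.2 (by omega)
      have := hy this
      omega
    · obtain ⟨a, ha, hav⟩ := id h1
      refine ⟨Pi.single a 1, ?_⟩
      have : interact y i v = y a := by
        unfold interact; rw [if_pos h1, if_neg h2, hav]; ring
      rw [this, hav, longRow_add_one]
      simp [Pi.single_apply, ite_smul]
  · by_cases h2 : ∃ m : Fin k, m.succ = i ∧ v = y m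
    · obtain ⟨a, ha, hav⟩ := id h2
      refine ⟨Pi.single a (-1), ?_⟩
      have : interact y i v = y a + 1 := by
        unfold interact; rw [if_neg h1, if_pos h2, hav]; ring
      rw [this, hav, longRow_add_one]
      simp [Pi.single_apply, ite_smul, sub_eq_add_neg]
    · refine ⟨0, ?_⟩
      have : interact y i v = v := by
        unfold interact; rw [if_neg h1, if_neg h2]; ring
      simp [this]

/-- Blocking and pushing do not change `q`: they act on its matrix by row operations. -/
theorem q_interact {k : ℕ} (t : ℕ) (w : State k) (v : Fin (k + 1) → ℤ) {y : Fin k → ℤ}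
    (hy : StrictMono y) : q k t (fun i => interact y i (v i), y) w = q k t (v, y) w := by
  choose C hC using fun i => longRow_interact t w hy i (v i)
  have : (Matrix.of (Sum.elim (fun i => longRow k t w i (interact y i (v i)))
      (fun i => shortRow k t w (y i)))) =
      Matrix.fromBlocks 1 (Matrix.of C) 0 1 *
        (Matrix.of (Sum.elim (fun i => longRow k t w i (v i))
          (fun i => shortRow k t w (y i)))) := by
    ext (i | i) j
    · simp [Matrix.mul_apply, hC, Matrix.one_apply]
    · simp [Matrix.mul_apply, Matrix.one_apply]
  rw [q_eq_det_rows, q_eq_det_rows, this, Matrix.det_mul, Matrix.det_fromBlocks_zero₂₁]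
  simp

theorem q_eq_zero_of_not_injective {k : ℕ} (t : ℕ) (w : State k) (v : Fin (k + 1) → ℤ)
    {y : Fin k → ℤ} {a b : Fin k} (hab : a ≠ b) (h : y a = y b) : q k t (v, y) w = 0 := by
  rw [q_eq_det_rows]
  refine Matrix.det_zero_of_row_eq (i := .inr a) (j := .inr b) (by simpa using hab) ?_
  ext j
  simp [Matrix.of_apply, h]

/-- One joint step of the two lines with coin tosses `c`. -/
def update {k : ℕ} (z : State k) (c : Fin (k + 1) ⊕ Fin k → ℤ) : State k :=
  (fun i => interact (fun m => z.2 m + c (.inr m)) i (z.1 i + c (.inl i)),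
    fun m => z.2 m + c (.inr m))

/-- The backward equation for `q`: one step of the pair of lines, killed when two particles of the
shorter line meet. -/
theorem q_succ {k : ℕ} (t : ℕ) (z w : State k) (hz : StrictMono z.2) :
    q k (t + 1) z w = ∑ c ∈ tosses k with StrictMono (update z c).2,
      (1 / 2 : ℝ) ^ (2 * k + 1) * q k t (update z c) w := by
  rw [q_succ_eq_sum_free, Finset.sum_filter]
  refine Finset.sum_congr rfl fun c hc => ?_
  rw [mem_tosses] at hc
  split_ifs with hs
  · congr 1
    exact (q_interact t w (fun i => z.1 i + c (.inl i)) hs).symm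
  · simp only [StrictMono, not_forall] at hs
    obtain ⟨a, b, hab, hs⟩ := hs
    have h1 := hz hab
    have ha := hc (.inr a)
    have hb := hc (.inr b)
    rw [q_eq_zero_of_not_injective t w _ hab.ne, mul_zero]
    simp only [update] at hs
    show z.2 a + c (.inr a) = z.2 b + c (.inr b)
    omega

/-! ### Interlacing configurations and the initial value of `q` -/

theorem W.le {k : ℕ} {z : State k} (hz : z ∈ W k) {i : Fin (k + 1)} {j : Fin k}
    (hij : (i : ℕ) ≤ j) : z.1 i ≤ z.2 j := by
  obtain ⟨j, hj⟩ := j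
  induction j with
  | zero =>
    have : i = Fin.castSucc ⟨0, hj⟩ := Fin.ext (by simpa using hij)
    rw [this]; exact (hz _).1
  | succ j ih =>
    rcases Nat.lt_or_ge j i with h | h
    · have : i = Fin.castSucc ⟨j + 1, hj⟩ := Fin.ext (by simp at hij ⊢; omega)
      rw [this]; exact (hz _).1
    · have h1 := ih (by omega) h
      have h2 := (hz ⟨j, by omega⟩).2
      have h3 := (hz ⟨j + 1, hj⟩).1
      have : Fin.succ (⟨j, by omega⟩ : Fin k) = Fin.castSucc ⟨j + 1, hj⟩ := Fin.ext (by simp)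
      rw [this] at h2
      omega

theorem W.lt {k : ℕ} {z : State k} (hz : z ∈ W k) {i : Fin (k + 1)} {j : Fin k}
    (hij : (j : ℕ) < i) : z.2 j < z.1 i := by
  obtain ⟨i, hi⟩ := i
  simp only at hij
  obtain ⟨i, rfl⟩ : ∃ m, i = m + 1 := ⟨i - 1, by omega⟩
  have h2 := (hz ⟨i, by omega⟩).2
  have : Fin.succ (⟨i, by omega⟩ : Fin k) = ⟨i + 1, hi⟩ := rfl
  rw [this] at h2
  refine lt_of_le_of_lt ?_ h2
  rcases Nat.lt_or_ge j i with h | h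
  · have h3 : z.2 j < z.1 ⟨i, by omega⟩ := by
      obtain ⟨i, rfl⟩ : ∃ m, i = m + 1 := ⟨i - 1, by omega⟩
      have h4 := (hz j).2
      rcases eq_or_ne (j : ℕ) i with h5 | h5
      · rwa [show j.succ = ⟨i + 1, by omega⟩ from Fin.ext (by simp [h5])] at h4
      · have h6 : z.1 j.succ ≤ z.2 ⟨i, by omega⟩ := W.le hz (by simp; omega)
        have h7 := (hz ⟨i, by omega⟩).2
        have : Fin.succ (⟨i, by omega⟩ : Fin k) = ⟨i + 1, by omega⟩ := rfl
        rw [this] at h7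
        omega
    have h4 : z.1 ⟨i, by omega⟩ ≤ z.2 ⟨i, by omega⟩ := W.le hz le_rfl
    omega
  · rw [show j = ⟨i, by omega⟩ from Fin.ext (by simp; omega)]

theorem W.strictMono_short {k : ℕ} {z : State k} (hz : z ∈ W k) : StrictMono z.2 := by
  intro a b hab
  have h1 := W.lt hz (i := b.castSucc) (j := a) (by simpa using hab)
  have h2 := (hz b).1
  omega

theorem W.strictMono_long {k : ℕ} {z : State k} (hz : z ∈ W k) : StrictMono z.1 := by
  intro a b hab
  have hak : (a : ℕ) < k := by have := Fin.lt_def.1 hab; omega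
  have h1 := W.lt hz (i := b) (j := ⟨a, hak⟩) (by simpa using hab)
  have h2 := W.le hz (i := a) (j := ⟨a, hak⟩) le_rfl
  omega

theorem q_zero_self {k : ℕ} {z : State k} (hz : z ∈ W k) : q k 0 z z = 1 := by
  unfold q
  have hB : (Matrix.of fun (i : Fin (k + 1)) (j : Fin k) =>
      psum (convPow coin 0) (z.2 j - z.1 i) - (if (i : ℕ) ≤ (j : ℕ) then 1 else 0)) = 0 := by
    ext i j
    simp only [convPow, psum_delta_zero, Matrix.of_apply, Matrix.zero_apply]
    by_cases hij : (i : ℕ) ≤ j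
    · have := W.le hz hij
      rw [if_pos (by omega), if_pos hij, sub_self]
    · have := W.lt hz (not_le.1 hij)
      rw [if_neg (by omega), if_neg hij, sub_self]
  have hA : (Matrix.of fun (i j : Fin (k + 1)) => convPow coin 0 (z.1 j - z.1 i)) = 1 := by
    ext i j
    simp [convPow, delta_apply, Matrix.one_apply, sub_eq_zero,
      (W.strictMono_long hz).injective.eq_iff, eq_comm (a := j)]
  have hD : (Matrix.of fun (i j : Fin k) => convPow coin 0 (z.2 j - z.2 i)) = 1 := by
    ext i j
    simp [convPow, delta_apply, Matrix.one_apply, sub_eq_zero,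
      (W.strictMono_short hz).injective.eq_iff, eq_comm (a := j)]
  rw [hB, hA, hD, Matrix.det_fromBlocks_zero₁₂]
  simp

/-- If two configurations agree in front of particle `i` of the longer line and differ there, then
at time `0` the matrix of `q` has a vanishing row, or a column which, added to the column of the
preceding particle, vanishes. -/
theorem long_eq_of_q_zero_ne_zero {k : ℕ} {z w : State k} (hz : z ∈ W k) (hw : w ∈ W k)
    (hq : q k 0 z w ≠ 0) (i : Fin (k + 1)) (h1 : ∀ l < i, z.1 l = w.1 l)
    (h2 : ∀ l : Fin k, (l : ℕ) < i → z.2 l = w.2 l) : z.1 i = w.1 i := by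
  rw [q_eq_det_rows] at hq
  by_contra hne
  rcases lt_or_gt_of_ne hne with hlt | hgt
  -- If `z.1 i < w.1 i`, then the row of `z.1 i` vanishes.
  · refine hq (Matrix.det_eq_zero_of_row_eq_zero (.inl i) ?_)
    rintro (j | j)
    · simp only [Matrix.of_apply, Sum.elim_inl, longRow, convPow, delta_apply]
      rw [if_neg]
      rcases lt_or_ge j i with hj | hj
      · have := h1 j hj
        have := W.strictMono_long hz hj
        omega
      · have := (W.strictMono_long hw).monotone hj
        omega
    · simp only [Matrix.of_apply, Sum.elim_inl, Sum.elim_inr, longRow, convPow, psum_delta_zero]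
      rcases lt_or_ge (j : ℕ) i with hj | hj
      · have := h2 j hj
        have := W.lt hz hj
        rw [if_neg (by omega), if_neg (by omega), sub_zero]
      · have := W.le hw hj
        rw [if_pos (by omega), if_pos (by omega), sub_self]
  -- If `w.1 i < z.1 i`, then the column of `w.1 i` vanishes, unless the position just below `w.1 i`
  -- is taken by the preceding particle, whose column then cancels it.
  · by_cases hp : ∃ m : Fin k, m.succ = i ∧ w.1 i = z.2 m + 1
    · obtain ⟨m, hm, hwm⟩ := hp
      have hmi : (m : ℕ) < i := by rw [← hm]; simp
      rw [← Matrix.det_updateCol_add_self _ (show Sum.inl i ≠ Sum.inr m by simp)] at hq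
      refine hq (Matrix.det_eq_zero_of_column_eq_zero (.inl i) ?_)
      have hmm := h2 m hmi
      rintro (l | l)
      · simp only [Matrix.updateCol_self, Matrix.of_apply, Sum.elim_inl, Sum.elim_inr, longRow,
          convPow, psum_delta_zero, delta_apply]
        have ha : w.1 i - z.1 l ≠ 0 := by
          rcases lt_or_ge l i with hl | hl
          · have := h1 l hl
            have := W.strictMono_long hw hl
            omega
          · have := (W.strictMono_long hz).monotone hl
            omega
        rw [if_neg ha]
        rcases lt_or_ge (m : ℕ) l with hl | hl
        · have := W.lt hz hl
          rw [if_neg (by omega), if_neg (by omega)]; simp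
        · have := W.le hz hl
          rw [if_pos (by omega), if_pos (by omega)]; simp
      · simp only [Matrix.updateCol_self, Matrix.of_apply, Sum.elim_inl, Sum.elim_inr, shortRow,
          convPow, delta_apply, bdiff_apply]
        have hinj := (W.strictMono_short hz).injective.eq_iff (a := l) (b := m)
        by_cases hl : l = m
        · subst hl
          rw [if_neg (by omega), if_pos (by omega), if_pos (by omega)]; simp
        · have hzl : z.2 l ≠ z.2 m := fun h => hl (hinj.1 h)
          have : w.1 i - z.2 l ≠ 0 := by
            rcases lt_or_ge (l : ℕ) i with hli | hli
            · have := W.lt hw hli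
              have := h2 l hli
              omega
            · have := W.le hz hli
              omega
          rw [if_neg (by omega), if_neg (by omega), if_neg (by omega)]; simp
    · refine hq (Matrix.det_eq_zero_of_column_eq_zero (.inl i) ?_)
      rintro (l | l)
      · simp only [Matrix.of_apply, Sum.elim_inl, longRow, convPow, delta_apply]
        rw [if_neg]
        rcases lt_or_ge l i with hl | hl
        · have := h1 l hl
          have := W.strictMono_long hw hl
          omega
        · have := (W.strictMono_long hz).monotone hl
          omega
      · simp only [Matrix.of_apply, Sum.elim_inl, Sum.elim_inr, shortRow, convPow, delta_apply,
          bdiff_apply]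
        rcases lt_or_ge (l : ℕ) i with hli | hli
        · have h3 := W.lt hw hli
          have h4 := h2 l hli
          rw [if_neg (by omega), if_neg, sub_zero]
          intro h5
          rcases eq_or_ne ((l : ℕ) + 1) i with h6 | h6
          · exact hp ⟨l, Fin.ext (by simpa using h6), by omega⟩
          · have h7 := W.lt hw (i := l.succ) (j := l) (by simp)
            have h8 := W.strictMono_long hw (show l.succ < i from Fin.lt_def.2 (by simp; omega))
            omega
        · have := W.le hz hli
          rw [if_neg (by omega), if_neg (by omega), sub_zero]

/-- If two configurations agree in front of particle `i` of the shorter line and differ there, then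
at time `0` the matrix of `q` has a vanishing row or column, or two equal rows. -/
theorem short_eq_of_q_zero_ne_zero {k : ℕ} {z w : State k} (hz : z ∈ W k) (hw : w ∈ W k)
    (hq : q k 0 z w ≠ 0) (i : Fin k) (h1 : ∀ l : Fin (k + 1), (l : ℕ) ≤ i → z.1 l = w.1 l)
    (h2 : ∀ l < i, z.2 l = w.2 l) : z.2 i = w.2 i := by
  rw [q_eq_det_rows] at hq
  by_contra hne
  have hi := h1 i.castSucc (by simp)
  rcases lt_or_gt_of_ne hne with hlt | hgt
  · have hD : ∀ j, w.2 j - z.2 i ≠ 0 := fun j => by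
      rcases lt_or_ge j i with hj | hj
      · have := h2 j hj
        have := W.strictMono_short hz hj
        omega
      · have := (W.strictMono_short hw).monotone hj
        omega
    have hC : ∀ j : Fin (k + 1), (i : ℕ) < j → w.1 j - z.2 i ≠ 0 ∧ w.1 j - z.2 i - 1 ≠ 0 :=
      fun j hj => by
        have := W.lt hw hj
        omega
    have hC' : ∀ j : Fin (k + 1), (j : ℕ) ≤ i → w.1 j - z.2 i - 1 ≠ 0 := fun j hj => by
      have := h1 j hj
      have := W.le hz hj
      omega
    have hC'' : ∀ j : Fin (k + 1), (j : ℕ) < i → w.1 j - z.2 i ≠ 0 := fun j hj => by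
      have := h1 j hj.le
      have := W.strictMono_long hz (show j < i.castSucc from Fin.lt_def.2 (by simpa using hj))
      have := (hz i).1
      omega
    -- The row of `z.2 i` vanishes, or it equals the row of `z.1 i` if both positions agree.
    by_cases hx : z.1 i.castSucc = z.2 i
    · refine hq (Matrix.det_zero_of_row_eq (i := .inl i.castSucc) (j := .inr i) (by simp) ?_)
      ext (j | j)
      · simp only [Matrix.of_apply, Sum.elim_inl, Sum.elim_inr, longRow, shortRow, convPow,
          delta_apply, bdiff_apply, hx]
        have : w.1 j - z.2 i - 1 ≠ 0 := by
          rcases lt_or_ge (i : ℕ) j with hj | hj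
          · exact (hC j hj).2
          · exact hC' j hj
        rw [if_neg this, sub_zero]
      · simp only [Matrix.of_apply, Sum.elim_inl, Sum.elim_inr, longRow, shortRow, convPow,
          delta_apply, psum_delta_zero]
        rw [if_neg (hD j)]
        rcases lt_or_ge j i with hj | hj
        · have := h2 j hj
          have := W.lt hz (i := i.castSucc) (j := j) (by simpa using hj)
          have : ¬ ((i.castSucc : ℕ) ≤ j) := by simpa using hj
          rw [if_neg (by omega), if_neg this, sub_zero]
        · have := W.le hw (i := i.castSucc) (j := j) (by simpa using hj)
          have : ((i.castSucc : ℕ) ≤ j) := by simpa using hj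
          rw [if_pos (by omega), if_pos this, sub_self]
    · refine hq (Matrix.det_eq_zero_of_row_eq_zero (.inr i) ?_)
      rintro (j | j)
      · simp only [Matrix.of_apply, Sum.elim_inl, Sum.elim_inr, shortRow, convPow,
          delta_apply, bdiff_apply]
        rcases lt_trichotomy (j : ℕ) i with hj | hj | hj
        · rw [if_neg (hC'' j hj), if_neg (hC' j hj.le), sub_zero]
        · obtain rfl : j = i.castSucc := Fin.ext (by simpa using hj)
          rw [if_neg (by omega), if_neg (hC' _ (by simp)), sub_zero]
        · rw [if_neg (hC j hj).1, if_neg (hC j hj).2, sub_zero]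
      · simp only [Matrix.of_apply, Sum.elim_inr, shortRow, convPow, delta_apply]
        rw [if_neg (hD j)]
  -- If `w.2 i < z.2 i`, then the column of `w.2 i` vanishes.
  · refine hq (Matrix.det_eq_zero_of_column_eq_zero (.inr i) ?_)
    rintro (l | l)
    · simp only [Matrix.of_apply, Sum.elim_inl, Sum.elim_inr, longRow, convPow, psum_delta_zero]
      rcases lt_or_ge (i : ℕ) l with hl | hl
      · have := W.lt hz hl
        rw [if_neg (by omega), if_neg (by omega), sub_zero]
      · have := h1 l hl
        have := W.le hw hl
        rw [if_pos (by omega), if_pos (by omega), sub_self]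
    · simp only [Matrix.of_apply, Sum.elim_inr, shortRow, convPow, delta_apply]
      rw [if_neg]
      rcases lt_or_ge l i with hl | hl
      · have := h2 l hl
        have := W.strictMono_short hw hl
        omega
      · have := (W.strictMono_short hz).monotone hl
        omega

theorem q_zero {k : ℕ} {z w : State k} (hz : z ∈ W k) (hw : w ∈ W k) :
    q k 0 z w = if z = w then 1 else 0 := by
  split_ifs with hzw
  · rw [← hzw, q_zero_self hz]
  · by_contra hq
    refine hzw ?_
    have key : ∀ n : ℕ, (∀ hn : n < k + 1, z.1 ⟨n, hn⟩ = w.1 ⟨n, hn⟩) ∧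
        (∀ hn : n < k, z.2 ⟨n, hn⟩ = w.2 ⟨n, hn⟩) := by
      intro n
      induction n using Nat.strong_induction_on with
      | _ n ih =>
        have h1 : ∀ hn : n < k + 1, z.1 ⟨n, hn⟩ = w.1 ⟨n, hn⟩ := fun hn =>
          long_eq_of_q_zero_ne_zero hz hw hq ⟨n, hn⟩ (fun l hl => (ih l hl).1 l.2)
            (fun l hl => (ih l hl).2 l.2)
        refine ⟨h1, fun hn => short_eq_of_q_zero_ne_zero hz hw hq ⟨n, hn⟩ (fun l hl => ?_)
          (fun l hl => (ih l hl).2 l.2)⟩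
        rcases Nat.lt_or_ge l n with h | h
        · exact (ih l h).1 l.2
        · rw [show l = ⟨n, by omega⟩ from Fin.ext (le_antisymm hl h)]
          exact h1 _
    exact Prod.ext (funext fun i => (key i).1 i.2) (funext fun i => (key i).2 i.2)

/-! ### One step of the pair of lines -/

instance (k : ℕ) : DecidablePred (· ∈ W k) := fun z =>
  inferInstanceAs (Decidable (∀ i : Fin k, z.1 i.castSucc ≤ z.2 i ∧ z.2 i < z.1 i.succ))

theorem exists_castSucc_eq_and_iff {k : ℕ} {i : Fin (k + 1)} {m : Fin k} (hm : m.castSucc = i)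
    (P : Fin k → Prop) : (∃ a : Fin k, a.castSucc = i ∧ P a) ↔ P m := by
  subst hm; simp

theorem exists_succ_eq_and_iff {k : ℕ} {i : Fin (k + 1)} {m : Fin k} (hm : m.succ = i)
    (P : Fin k → Prop) : (∃ a : Fin k, a.succ = i ∧ P a) ↔ P m := by
  subst hm; simp

theorem lt_of_succ_eq_castSucc {k : ℕ} {a b : Fin k} (h : a.succ = b.castSucc) : a < b := by
  have := congrArg Fin.val h
  simp at this
  exact Fin.lt_def.2 (by omega)

/-- Blocking and pushing preserve interlacing, and every particle of the longer line still moves by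
`0` or `1`. -/
theorem update_mem_W {k : ℕ} {z : State k} (hz : z ∈ W k) {c : Fin (k + 1) ⊕ Fin k → ℤ}
    (hc : c ∈ tosses k) (hs : StrictMono (update z c).2) :
    update z c ∈ W k ∧ ∀ i, (update z c).1 i = z.1 i ∨ (update z c).1 i = z.1 i + 1 := by
  rw [mem_tosses] at hc
  set y := (update z c).2 with hy
  have hyz : ∀ m, y m = z.2 m ∨ y m = z.2 m + 1 := fun m => by
    have : y m = z.2 m + c (.inr m) := rfl
    have := hc (.inr m)
    omega
  have hx : ∀ i, (update z c).1 i = interact y i (z.1 i + c (.inl i)) := fun i => rfl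
  have key : ∀ i, ((update z c).1 i = z.1 i ∨ (update z c).1 i = z.1 i + 1) ∧
      (∀ m : Fin k, m.castSucc = i → (update z c).1 i ≤ y m) ∧
      (∀ m : Fin k, m.succ = i → y m < (update z c).1 i) := by
    intro i
    have hci := hc (.inl i)
    have hup : ∀ m : Fin k, m.castSucc = i → z.1 i ≤ z.2 m := fun m hm => hm ▸ (hz m).1
    have hlo : ∀ m : Fin k, m.succ = i → z.2 m < z.1 i := fun m hm => hm ▸ (hz m).2
    rw [hx, interact]
    by_cases h1 : ∃ m : Fin k, m.castSucc = i <;> by_cases h2 : ∃ m : Fin k, m.succ = i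
    · obtain ⟨a, ha⟩ := h1
      obtain ⟨b, hb⟩ := h2
      have hab := hs (lt_of_succ_eq_castSucc (hb.trans ha.symm))
      rw [if_congr (exists_castSucc_eq_and_iff ha _) rfl rfl,
        if_congr (exists_succ_eq_and_iff hb _) rfl rfl]
      have := hyz a
      have := hyz b
      have := hup a ha
      have := hlo b hb
      refine ⟨?_, fun m hm => ?_, fun m hm => ?_⟩
      · split_ifs <;> omega
      · obtain rfl : m = a := Fin.castSucc_injective _ (hm.trans ha.symm)
        split_ifs <;> omega
      · obtain rfl : m = b := Fin.succ_injective _ (hm.trans hb.symm)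
        split_ifs <;> omega
    · obtain ⟨a, ha⟩ := h1
      have h2' : ¬ ∃ m : Fin k, m.succ = i ∧ z.1 i + c (.inl i) = y m :=
        fun ⟨m, hm, _⟩ => h2 ⟨m, hm⟩
      rw [if_congr (exists_castSucc_eq_and_iff ha _) rfl rfl, if_neg h2']
      have := hyz a
      have := hup a ha
      refine ⟨?_, fun m hm => ?_, fun m hm => (h2 ⟨m, hm⟩).elim⟩
      · split_ifs <;> omega
      · obtain rfl : m = a := Fin.castSucc_injective _ (hm.trans ha.symm)
        split_ifs <;> omega
    · obtain ⟨b, hb⟩ := h2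
      have h1' : ¬ ∃ m : Fin k, m.castSucc = i ∧ z.1 i + c (.inl i) = y m + 1 :=
        fun ⟨m, hm, _⟩ => h1 ⟨m, hm⟩
      rw [if_congr (exists_succ_eq_and_iff hb _) rfl rfl, if_neg h1']
      have := hyz b
      have := hlo b hb
      refine ⟨?_, fun m hm => (h1 ⟨m, hm⟩).elim, fun m hm => ?_⟩
      · split_ifs <;> omega
      · obtain rfl : m = b := Fin.succ_injective _ (hm.trans hb.symm)
        split_ifs <;> omega
    · have h1' : ¬ ∃ m : Fin k, m.castSucc = i ∧ z.1 i + c (.inl i) = y m + 1 :=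
        fun ⟨m, hm, _⟩ => h1 ⟨m, hm⟩
      have h2' : ¬ ∃ m : Fin k, m.succ = i ∧ z.1 i + c (.inl i) = y m :=
        fun ⟨m, hm, _⟩ => h2 ⟨m, hm⟩
      rw [if_neg h1', if_neg h2']
      refine ⟨by omega, fun m hm => (h1 ⟨m, hm⟩).elim, fun m hm => (h2 ⟨m, hm⟩).elim⟩
  exact ⟨fun m => ⟨(key _).2.1 m rfl, (key _).2.2 m rfl⟩, fun i => (key i).1⟩

/-- The probability that the longer line goes from `x` to `x'` in one step, given the new positions
`y` of the shorter line. -/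
def longStepProb {k : ℕ} (x : Fin (k + 1) → ℤ) (y : Fin k → ℤ) (x' : Fin (k + 1) → ℤ) : ℝ :=
  ∏ i, ∑ e ∈ ({0, 1} : Finset ℤ), if interact y i (x i + e) = x' i then (1 / 2 : ℝ) else 0

/-- The probability that independent fair coin-toss walks go from `y` to `y'` in one step. -/
def walkStepProb {k : ℕ} (y y' : Fin k → ℤ) : ℝ :=
  ∏ m, ∑ e ∈ ({0, 1} : Finset ℤ), if y m + e = y' m then (1 / 2 : ℝ) else 0

/-- The one-step weight of the pair of lines when the shorter line performs independent walks,
killed when two of its particles meet. -/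
def killedStep {k : ℕ} (z w : State k) : ℝ :=
  (if StrictMono w.2 then 1 else 0) * walkStepProb z.2 w.2 * longStepProb z.1 w.2 w.1

theorem killedStep_eq_sum {k : ℕ} (z w : State k) :
    killedStep z w = ∑ c ∈ tosses k with StrictMono (update z c).2,
      if update z c = w then (1 / 2 : ℝ) ^ (2 * k + 1) else 0 := by
  set F : Fin (k + 1) ⊕ Fin k → ℤ → ℝ := fun r e => Sum.elim
    (fun i => if interact w.2 i (z.1 i + e) = w.1 i then (1 / 2 : ℝ) else 0)
    (fun m => if z.2 m + e = w.2 m then (1 / 2 : ℝ) else 0) r with hF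
  have h1 : walkStepProb z.2 w.2 * longStepProb z.1 w.2 w.1 =
      ∏ r : Fin (k + 1) ⊕ Fin k, ∑ e ∈ ({0, 1} : Finset ℤ), F r e := by
    rw [Fintype.prod_sum_type, mul_comm]
    rfl
  rw [killedStep, mul_assoc, h1, Finset.prod_univ_sum, Finset.mul_sum, Finset.sum_filter]
  refine Finset.sum_congr rfl fun c _ => ?_
  have h2 : update z c = w ↔ (∀ i, interact w.2 i (z.1 i + c (.inl i)) = w.1 i) ∧
      ∀ m, z.2 m + c (.inr m) = w.2 m := by
    constructor
    · rintro rfl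
      exact ⟨fun _ => rfl, fun _ => rfl⟩
    · rintro ⟨ha, hb⟩
      have hb' : (fun m => z.2 m + c (.inr m)) = w.2 := funext hb
      refine Prod.ext (funext fun i => ?_) hb'
      rw [← ha i, ← hb']
      rfl
  simp only [hF, Fintype.prod_sum_type, Sum.elim_inl, Sum.elim_inr, Finset.prod_ite_zero,
    Finset.mem_univ, forall_true_left, Finset.prod_const, Finset.card_univ, Fintype.card_fin]
  by_cases h3 : update z c = w
  · rw [if_pos (h2.1 h3).1, if_pos (h2.1 h3).2, if_pos h3, ← pow_add,
      show k + 1 + k = 2 * k + 1 by omega]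
    subst h3
    split_ifs <;> simp
  · rw [if_neg h3, ite_self]
    by_cases h4 : ∀ i, interact w.2 i (z.1 i + c (.inl i)) = w.1 i
    · rw [if_neg (fun h5 => h3 (h2.2 ⟨h4, h5⟩))]; simp
    · rw [if_neg h4]; simp

/-- The possible predecessors of `y'` under independent coin-toss steps. -/
def predecessors {k : ℕ} (y' : Fin k → ℤ) : Finset (Fin k → ℤ) :=
  Fintype.piFinset fun m => {y' m - 1, y' m}

theorem mem_predecessors {k : ℕ} {y y' : Fin k → ℤ} :
    y ∈ predecessors y' ↔ ∀ m, y' m = y m ∨ y' m = y m + 1 := by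
  simp only [predecessors, Fintype.mem_piFinset, Finset.mem_insert, Finset.mem_singleton]
  exact forall_congr' fun m => by omega

theorem walkStepProb_eq {k : ℕ} (y y' : Fin k → ℤ) :
    walkStepProb y y' = if y ∈ predecessors y' then (1 / 2 : ℝ) ^ k else 0 := by
  have : ∀ m, (∑ e ∈ ({0, 1} : Finset ℤ), if y m + e = y' m then (1 / 2 : ℝ) else 0) =
      if y' m = y m ∨ y' m = y m + 1 then (1 / 2 : ℝ) else 0 := fun m => by
    rw [Finset.sum_pair (by norm_num)]
    split_ifs <;> first | omega | norm_num
  simp only [walkStepProb, this, Finset.prod_ite_zero, mem_predecessors]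
  simp

/-- For a particle that is blocked or pushed, both outcomes of its coin lead to the same position.
-/
theorem longStepProb_factor {k : ℕ} {x x' : Fin (k + 1) → ℤ} {y : Fin k → ℤ} (hy : StrictMono y)
    (hW : (x', y) ∈ W k) (i : Fin (k + 1)) (hx : x' i = x i ∨ x' i = x i + 1) :
    (∑ e ∈ ({0, 1} : Finset ℤ), if interact y i (x i + e) = x' i then (1 / 2 : ℝ) else 0) =
      (1 / 2) * ((if ∃ m : Fin k, m.castSucc = i ∧ x i = y m then 2 else 1) *
        (if ∃ m : Fin k, m.succ = i ∧ x i = y m then 2 else 1)) := by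
  have hup : ∀ m : Fin k, m.castSucc = i → x' i ≤ y m := fun m hm => hm ▸ (hW m).1
  have hlo : ∀ m : Fin k, m.succ = i → y m < x' i := fun m hm => hm ▸ (hW m).2
  rw [Finset.sum_pair (by norm_num)]
  simp only [interact]
  by_cases h1 : ∃ m : Fin k, m.castSucc = i <;> by_cases h2 : ∃ m : Fin k, m.succ = i
  · obtain ⟨a, ha⟩ := h1
    obtain ⟨b, hb⟩ := h2
    have hab := hy (lt_of_succ_eq_castSucc (hb.trans ha.symm))
    simp only [exists_castSucc_eq_and_iff ha, exists_succ_eq_and_iff hb]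
    have := hup a ha
    have := hlo b hb
    split_ifs <;> first | omega | norm_num
  · obtain ⟨a, ha⟩ := h1
    have h2' : ∀ P : Fin k → Prop, (∃ m : Fin k, m.succ = i ∧ P m) ↔ False :=
      fun P => ⟨fun ⟨m, hm, _⟩ => h2 ⟨m, hm⟩, False.elim⟩
    simp only [exists_castSucc_eq_and_iff ha, h2', if_false]
    have := hup a ha
    split_ifs <;> first | omega | norm_num
  · obtain ⟨b, hb⟩ := h2
    have h1' : ∀ P : Fin k → Prop, (∃ m : Fin k, m.castSucc = i ∧ P m) ↔ False :=
      fun P => ⟨fun ⟨m, hm, _⟩ => h1 ⟨m, hm⟩, False.elim⟩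
    simp only [exists_succ_eq_and_iff hb, h1', if_false]
    have := hlo b hb
    split_ifs <;> first | omega | norm_num
  · have h2' : ∀ P : Fin k → Prop, (∃ m : Fin k, m.succ = i ∧ P m) ↔ False :=
      fun P => ⟨fun ⟨m, hm, _⟩ => h2 ⟨m, hm⟩, False.elim⟩
    have h1' : ∀ P : Fin k → Prop, (∃ m : Fin k, m.castSucc = i ∧ P m) ↔ False :=
      fun P => ⟨fun ⟨m, hm, _⟩ => h1 ⟨m, hm⟩, False.elim⟩
    simp only [h1', h2', if_false]
    split_ifs <;> first | omega | norm_num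

theorem longStepProb_eq_prod {k : ℕ} {x x' : Fin (k + 1) → ℤ} {y : Fin k → ℤ} (hy : StrictMono y)
    (hW : (x', y) ∈ W k) (hx : ∀ i, x' i = x i ∨ x' i = x i + 1) :
    longStepProb x y x' = (1 / 2) ^ (k + 1) * ∏ m : Fin k,
      ((if x m.castSucc = y m then 2 else 1) * (if x m.succ = y m then 2 else 1)) := by
  rw [longStepProb, Finset.prod_congr rfl fun i _ => longStepProb_factor hy hW i (hx i),
    Finset.prod_mul_distrib, Finset.prod_mul_distrib, Finset.prod_mul_distrib,
    Fin.prod_univ_castSucc (n := k) (f := fun i =>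
      if ∃ m : Fin k, m.castSucc = i ∧ x i = y m then (2 : ℝ) else 1),
    Fin.prod_univ_succ (n := k) (f := fun i =>
      if ∃ m : Fin k, m.succ = i ∧ x i = y m then (2 : ℝ) else 1)]
  have h1 : ¬ ∃ m : Fin k, m.castSucc = Fin.last k ∧ x (Fin.last k) = y m :=
    fun ⟨m, hm, _⟩ => (Fin.castSucc_lt_last m).ne hm
  have h2 : ¬ ∃ m : Fin k, m.succ = 0 ∧ x 0 = y m := fun ⟨m, hm, _⟩ => Fin.succ_ne_zero m hm
  rw [if_neg h1, if_neg h2]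
  simp

/-- The local form of the intertwining between consecutive lines: a particle of the longer line
that is blocked or pushed loses one coin's worth of freedom, and this makes up for the positions
that interlacing forbids to the shorter line at the preceding time. -/
theorem sum_longStepProb {k : ℕ} {x x' : Fin (k + 1) → ℤ} {y' : Fin k → ℤ} (hx : StrictMono x)
    (hy' : StrictMono y') :
    ∑ y ∈ predecessors y' with (x, y) ∈ W k, longStepProb x y' x' =
      if (x', y') ∈ W k ∧ ∀ i, x' i = x i ∨ x' i = x i + 1 then 1 / 2 else 0 := by
  split_ifs with h
  · obtain ⟨hW, hstep⟩ := h
    have hset : (predecessors y').filter (fun y => (x, y) ∈ W k) = Fintype.piFinset fun m : Fin k =>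
        ({y' m - 1, y' m} : Finset ℤ).filter fun v => x m.castSucc ≤ v ∧ v < x m.succ := by
      ext y
      rw [Finset.mem_filter, predecessors, Fintype.mem_piFinset, Fintype.mem_piFinset]
      simp only [Finset.mem_filter]
      exact forall_and.symm
    rw [Finset.sum_const, hset, Fintype.card_piFinset, nsmul_eq_mul,
      longStepProb_eq_prod hy' hW hstep, mul_left_comm, Nat.cast_prod, ← Finset.prod_mul_distrib]
    -- Each particle `m` of the shorter line has one or two possible predecessors; the missing one
    -- is made up for by the idle coin of the particle it blocks (at `y' m = x m.castSucc`) or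
    -- pushes (at `y' m = x m.succ`). Both cannot happen, since `x` is strictly increasing.
    have : ∀ m : Fin k, (((({y' m - 1, y' m} : Finset ℤ).filter
        fun v => x m.castSucc ≤ v ∧ v < x m.succ).card : ℕ) : ℝ) *
        ((if x m.castSucc = y' m then 2 else 1) * (if x m.succ = y' m then 2 else 1)) = 2 := by
      intro m
      have h1 := hx (Fin.castSucc_lt_succ (i := m))
      have h2 := hW m
      have h3 := hstep m.castSucc
      have h4 := hstep m.succ
      simp only at h2
      rw [Finset.filter_insert, Finset.filter_singleton]
      split_ifs <;> first | omega | simp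
    rw [Finset.prod_congr rfl fun m _ => this m]
    simp only [Finset.prod_const, Finset.card_univ, Fintype.card_fin]
    rw [pow_succ, mul_right_comm, ← mul_pow]
    norm_num
  -- A nonzero term is a possible step from an interlacing configuration.
  · refine Finset.sum_eq_zero fun y hy => ?_
    rw [Finset.mem_filter] at hy
    by_contra hne
    refine h ?_
    have h1 : killedStep (x, y) (x', y') ≠ 0 := by
      rw [killedStep, walkStepProb_eq]
      simp only
      rw [if_pos hy', if_pos hy.1]
      simp [hne]
    rw [killedStep_eq_sum] at h1
    obtain ⟨c, hc, hcz⟩ := Finset.exists_ne_zero_of_sum_ne_zero h1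
    rw [Finset.mem_filter] at hc
    have h2 : update (x, y) c = (x', y') := by
      by_contra h2
      exact hcz (if_neg h2)
    have := update_mem_W hy.2 hc.1 hc.2
    rwa [h2] at this

/-! ### Summing the Vandermonde product over interlacing configurations -/

theorem h_pos {k : ℕ} {y : Fin k → ℤ} (hy : StrictMono y) : 0 < h y :=
  Finset.prod_pos fun i _ => Finset.prod_pos fun j hj => by
    have := hy (Finset.mem_Ioi.1 hj)
    have : (y i : ℝ) < y j := by exact_mod_cast this
    linarith

theorem h_eq_det {k : ℕ} (y : Fin k → ℤ) :
    h y = (Matrix.of fun i j : Fin k => (descPochhammer ℝ j).eval (y i : ℝ)).det := by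
  rw [← Matrix.det_eval_matrixOfPolynomials_eq_det_vandermonde (fun i => (y i : ℝ))
    (fun j : Fin k => descPochhammer ℝ j) (fun i => descPochhammer_natDegree ℝ i)
    (fun i => monic_descPochhammer ℝ i), Matrix.det_vandermonde]
  rfl

theorem sum_descPochhammer (j : ℕ) {a b : ℤ} (hab : a ≤ b) :
    ∑ v ∈ Finset.Ico a b, (descPochhammer ℝ j).eval (v : ℝ) =
      ((j : ℝ) + 1)⁻¹ * ((descPochhammer ℝ (j + 1)).eval (b : ℝ) -
        (descPochhammer ℝ (j + 1)).eval (a : ℝ)) := by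
  have hj : (j : ℝ) + 1 ≠ 0 := by positivity
  induction b, hab using Int.leInduction with
  | base => simp
  | succ b hb ih =>
    have : Finset.Ico a (b + 1) = insert b (Finset.Ico a b) := by ext; simp; omega
    rw [this, Finset.sum_insert (by simp), ih]
    have h1 : (descPochhammer ℝ (j + 1)).eval ((b + 1 : ℤ) : ℝ) =
        (b + 1) * (descPochhammer ℝ j).eval (b : ℝ) := by
      rw [descPochhammer_succ_left]
      simp
    rw [h1, descPochhammer_succ_eval]
    field_simp
    ring

/-- The positions of a line of `k` particles that interlaces with the line `x`. -/
def interlacing {k : ℕ} (x : Fin (k + 1) → ℤ) : Finset (Fin k → ℤ) :=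
  Fintype.piFinset fun m => Finset.Ico (x m.castSucc) (x m.succ)

theorem mem_interlacing {k : ℕ} {x : Fin (k + 1) → ℤ} {y : Fin k → ℤ} :
    y ∈ interlacing x ↔ (x, y) ∈ W k := by
  simp [interlacing, Fintype.mem_piFinset, W]

/-- The sum of `h_k` over the lines interlacing with `x` is `h_{k+1}(x) / k!`: in the basis of
falling factorials, summation over an interval turns the Vandermonde determinant of size `k` into
that of size `k + 1`. -/
theorem sum_interlacing_h {k : ℕ} {x : Fin (k + 1) → ℤ} (hx : StrictMono x) :
    ∑ y ∈ interlacing x, h y = (∏ j : Fin k, ((j : ℝ) + 1)⁻¹) * h x := by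
  set p : ℕ → ℤ → ℝ := fun j v => (descPochhammer ℝ j).eval (v : ℝ) with hp
  have h1 : ∑ y ∈ interlacing x, h y = (Matrix.of fun i j : Fin k =>
      ∑ v ∈ Finset.Ico (x i.castSucc) (x i.succ), p j v).det := by
    have := (Matrix.detRowAlternating (R := ℝ) (n := Fin k)).toMultilinearMap.map_sum_finset
      (fun (_ : Fin k) (v : ℤ) (j : Fin k) => p j v)
      (fun i => Finset.Ico (x i.castSucc) (x i.succ))
    refine Eq.trans (Finset.sum_congr rfl fun y _ => ?_) (this.symm.trans ?_)
    · exact h_eq_det y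
    · change Matrix.det _ = Matrix.det _
      congr 1
      ext i j
      simp [Finset.sum_apply]
  -- Subtract from each row its predecessor and expand along the first column, which is constant.
  have h2 : h x = (Matrix.of fun i j : Fin k =>
      p (j + 1) (x i.succ) - p (j + 1) (x i.castSucc)).det := by
    have hrow := Matrix.det_eq_of_forall_row_eq_smul_add_pred (fun _ => 1)
      (A := Matrix.of fun i j : Fin (k + 1) => p j (x i))
      (B := Matrix.of fun i j : Fin (k + 1) => Fin.cases (motive := fun _ => ℝ) (p j (x 0))
        (fun i' : Fin k => p j (x i'.succ) - p j (x i'.castSucc)) i)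
      (fun j => rfl) (fun i j => by simp)
    rw [h_eq_det]
    refine hrow.trans ?_
    rw [Matrix.det_succ_column_zero, Fin.sum_univ_succ]
    rw [Finset.sum_eq_zero fun i _ => by simp [hp]]
    simp only [Matrix.of_apply, Fin.cases_zero, add_zero]
    have : p 0 (x 0) = 1 := by simp [hp]
    simp only [Fin.val_zero, pow_zero, this, one_mul]
    congr 1
  rw [h1, h2, ← Matrix.det_mul_row]
  congr 1
  ext i j
  simp only [Matrix.of_apply]
  exact sum_descPochhammer j (hx (Fin.castSucc_lt_succ (i := i))).le

/-! ### The process driven by the coins -/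

variable {Ω : Type*}

/-- The random positions of all particles of line `j` at time `t`. -/
def line (β : ℕ → ℕ → ℕ → Ω → ℤ) (j t : ℕ) (ω : Ω) : Fin j → ℤ := fun i => X β j (i + 1) t ω

theorem pair_eq (β : ℕ → ℕ → ℕ → Ω → ℤ) (k t : ℕ) (ω : Ω) :
    pair β k t ω = (line β (k + 1) t ω, line β k t ω) := rfl

/-- The initial positions of line `j`. -/
def start (j : ℕ) : Fin j → ℤ := fun i => ((i : ℕ) : ℤ) + 1

theorem line_zero (β : ℕ → ℕ → ℕ → Ω → ℤ) (j : ℕ) (ω : Ω) :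
    line β j 0 ω = start j := by
  funext i
  cases j with
  | zero => exact i.elim0
  | succ j => simp [line, X, lines, start]

theorem line_succ (β : ℕ → ℕ → ℕ → Ω → ℤ) (k t : ℕ) (ω : Ω) (i : Fin (k + 1)) :
    line β (k + 1) (t + 1) ω i = interact (line β k (t + 1) ω) i
      (line β (k + 1) t ω i + β (k + 1) (i + 1) (t + 1) ω) := by
  have h1 : ∀ v : ℤ, (∃ m : Fin k, m.castSucc = i ∧ v = line β k (t + 1) ω m + 1) ↔
      ((i : ℕ) + 1 < k + 1 ∧ v = X β k (i + 1) (t + 1) ω + 1) := fun v => by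
    constructor
    · rintro ⟨m, rfl, h⟩
      exact ⟨by simp, h⟩
    · rintro ⟨hi, h⟩
      exact ⟨⟨i, by omega⟩, Fin.ext rfl, h⟩
  have h2 : ∀ v : ℤ, (∃ m : Fin k, m.succ = i ∧ v = line β k (t + 1) ω m) ↔
      (1 < (i : ℕ) + 1 ∧ v = X β k ((i : ℕ) + 1 - 1) (t + 1) ω) := fun v => by
    constructor
    · rintro ⟨m, rfl, h⟩
      exact ⟨by simp, by simpa [line] using h⟩
    · rintro ⟨hi, h⟩
      refine ⟨⟨i - 1, by omega⟩, Fin.ext (by simp; omega), ?_⟩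
      rw [h, line]
      congr 1
      simp only
      omega
  rw [interact, if_congr (h1 _) rfl rfl, if_congr (h2 _) rfl rfl]
  simp only [line, X, lines]
  rfl

/-- The coin tosses behind the step from time `t` to time `t + 1`, where the increments of line `k`
stand for its coins. -/
def stepTosses (β : ℕ → ℕ → ℕ → Ω → ℤ) (k t : ℕ) (ω : Ω) : Fin (k + 1) ⊕ Fin k → ℤ :=
  Sum.elim (fun i => β (k + 1) (i + 1) (t + 1) ω)
    (fun m => line β k (t + 1) ω m - line β k t ω m)

theorem pair_succ (β : ℕ → ℕ → ℕ → Ω → ℤ) (k t : ℕ) (ω : Ω) :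
    pair β k (t + 1) ω = update (pair β k t ω) (stepTosses β k t ω) := by
  have h2 : (fun m => line β k t ω m + stepTosses β k t ω (.inr m)) = line β k (t + 1) ω := by
    funext m
    simp [stepTosses]
  rw [pair_eq, pair_eq, update]
  simp only [h2]
  refine Prod.ext (funext fun i => ?_) rfl
  exact line_succ β k t ω i

/-- The pathwise statement behind interlacing, by induction on the line: a line that moves by `0` or
`1` and stays strictly increasing keeps the next line interlaced, which therefore has the same
properties. -/
theorem line_interlacing_and_step {n : ℕ} {β : ℕ → ℕ → ℕ → Ω → ℤ} {ω : Ω}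
    (hω : ∀ p : CoinIndex n, β p.1.1 p.1.2.1 p.1.2.2 ω = 0 ∨ β p.1.1 p.1.2.1 p.1.2.2 ω = 1)
    {k : ℕ} (hk : k ≤ n) : (∀ t, StrictMono (line β k t ω) ∧
      line β k t ω ∈ predecessors (line β k (t + 1) ω)) ∧
      (k < n → ∀ t, pair β k t ω ∈ W k ∧ stepTosses β k t ω ∈ tosses k) := by
  have next : ∀ k, k < n → (∀ t, StrictMono (line β k t ω) ∧
      line β k t ω ∈ predecessors (line β k (t + 1) ω)) →
      ∀ t, pair β k t ω ∈ W k ∧ stepTosses β k t ω ∈ tosses k := by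
    intro k hk ih
    have hc : ∀ t, stepTosses β k t ω ∈ tosses k := fun t => by
      rw [mem_tosses]
      rintro (i | m)
      · exact hω ⟨(k + 1, i + 1, t + 1), by simp; omega⟩
      · have := mem_predecessors.1 (ih t).2 m
        simp only [stepTosses, Sum.elim_inr]
        omega
    refine fun t => ⟨?_, hc t⟩
    induction t with
    | zero =>
      intro i
      simp [pair_eq, line_zero, start]
    | succ t iht =>
      rw [pair_succ]
      refine (update_mem_W iht (hc t) ?_).1
      rw [← pair_succ]
      exact (ih (t + 1)).1
  have main : ∀ t, StrictMono (line β k t ω) ∧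
      line β k t ω ∈ predecessors (line β k (t + 1) ω) := by
    induction k with
    | zero => exact fun t => ⟨fun i => i.elim0, mem_predecessors.2 fun i => i.elim0⟩
    | succ k ih =>
      have h1 := ih (by omega)
      have h2 := next k hk h1
      refine fun t => ⟨W.strictMono_long (h2 t).1, mem_predecessors.2 fun i => ?_⟩
      have h3 := (update_mem_W (h2 t).1 (h2 t).2 (by
        rw [← pair_succ]
        exact (h1 (t + 1)).1)).2 i
      rwa [← pair_succ] at h3
  exact ⟨main, fun hkn => next k hkn main⟩

theorem measurable_line_succ [MeasurableSpace Ω] {β : ℕ → ℕ → ℕ → Ω → ℤ} {k T : ℕ}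
    (h1 : ∀ t ≤ T, Measurable (line β k t))
    (h2 : ∀ (i : Fin (k + 1)), ∀ t < T, Measurable (β (k + 1) (i + 1) (t + 1))) :
    ∀ t ≤ T, Measurable (line β (k + 1) t) := by
  intro t ht
  induction t with
  | zero =>
    rw [show line β (k + 1) 0 = fun _ => start (k + 1) from
      funext fun ω => line_zero β (k + 1) ω]
    exact measurable_const
  | succ t ih =>
    rw [measurable_pi_iff]
    intro i
    have h3 : Measurable fun ω => (line β k (t + 1) ω,
        line β (k + 1) t ω i + β (k + 1) (i + 1) (t + 1) ω) :=
      (h1 _ ht).prodMk (((measurable_pi_apply i).comp (ih (by omega))).add (h2 i t (by omega)))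
    have h4 : Measurable fun p : (Fin k → ℤ) × ℤ => interact p.1 i p.2 :=
      measurable_from_prod_countable_right fun _ => measurable_of_countable _
    rw [show (fun ω => line β (k + 1) (t + 1) ω i) = _ from
      funext fun ω => line_succ β k t ω i]
    exact h4.comp h3

theorem measurable_line [MeasurableSpace Ω] {β : ℕ → ℕ → ℕ → Ω → ℤ} {k : ℕ}
    (hβ : ∀ j i t, 1 ≤ i → i ≤ j → j ≤ k → 1 ≤ t → Measurable (β j i t)) (t : ℕ) :
    Measurable (line β k t) := by
  induction k generalizing t with
  | zero => exact measurable_of_subsingleton_codomain _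
  | succ k ih =>
    refine measurable_line_succ (T := t) (fun s _ => ih (fun j i t a b c d =>
      hβ j i t a b (by omega) d) s) (fun i s _ => ?_) t le_rfl
    exact hβ _ _ _ (by omega) (by omega) le_rfl (by omega)

/-! ### Events split along a discrete random variable -/

section Disintegration

variable [MeasurableSpace Ω] {μ : Measure Ω} [IsFiniteMeasure μ] {α : Type*} [MeasurableSpace α]
  [MeasurableSingletonClass α]

theorem measureReal_eq_sum_fiber {Y : Ω → α} (hY : Measurable Y) (F : Finset α) {E : Set Ω}
    (h : ∀ᵐ ω ∂μ, ω ∈ E → Y ω ∈ F) : μ.real E = ∑ a ∈ F, μ.real (E ∩ {ω | Y ω = a}) := by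
  have h1 : ∀ a, MeasurableSet (Y ⁻¹' {a}) := fun a => hY (measurableSet_singleton a)
  have h2 := sum_measureReal_preimage_singleton (μ := μ.restrict E) F (f := Y) fun a _ => h1 a
  have h3 : MeasurableSet (Y ⁻¹' (F : Set α)) := hY F.measurableSet
  rw [measureReal_restrict_apply h3] at h2
  have h4 : μ.real (Y ⁻¹' (F : Set α) ∩ E) = μ.real E := by
    refine measureReal_congr ?_
    filter_upwards [h] with ω hω
    exact propext ⟨fun hx => hx.2, fun hx => ⟨hω hx, hx⟩⟩
  rw [h4] at h2
  rw [← h2]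
  refine Finset.sum_congr rfl fun a _ => ?_
  rw [measureReal_restrict_apply (h1 a), Set.inter_comm]
  rfl

variable [Countable α]

theorem measureReal_preimage_eq_tsum (μ : Measure Ω) [IsFiniteMeasure μ] {Y : Ω → α}
    (hY : Measurable Y) (A : Set α) : μ.real (Y ⁻¹' A) = ∑' a : A, μ.real (Y ⁻¹' {(a : α)}) := by
  rw [measureReal_def, ← tsum_measure_preimage_singleton A.to_countable
    fun a _ => hY (measurableSet_singleton a), ENNReal.tsum_toReal_eq fun a => measure_ne_top _ _]
  rfl

/-- A conditional probability that is the same on all atoms of a countable-valued random variable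
is also the conditional probability on every union of atoms. -/
theorem measureReal_inter_preimage_eq_mul {Y : Ω → α} (hY : Measurable Y) (A : Set α) {B : Set Ω}
    {c : ℝ} (h : ∀ a ∈ A, μ.real (Y ⁻¹' {a} ∩ B) = μ.real (Y ⁻¹' {a}) * c) :
    μ.real (Y ⁻¹' A ∩ B) = μ.real (Y ⁻¹' A) * c := by
  rw [← measureReal_restrict_apply (hY A.to_countable.measurableSet),
    measureReal_preimage_eq_tsum _ hY, measureReal_preimage_eq_tsum μ hY, ← tsum_mul_right]
  refine tsum_congr fun a => ?_
  rw [measureReal_restrict_apply (hY (measurableSet_singleton _)), h a a.2]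

end Disintegration

/-! ### Independence of the coins -/

section Coins

/-- The coins of lines `1, …, k`, and those of line `k + 1` up to time `s`. -/
def pastCoins (n k s : ℕ) : Set (CoinIndex n) := {p | p.1.1 ≤ k ∨ (p.1.1 = k + 1 ∧ p.1.2.2 ≤ s)}

/-- The `σ`-algebra generated by `pastCoins`. -/
abbrev pastSigma (n : ℕ) (β : ℕ → ℕ → ℕ → Ω → ℤ) (k s : ℕ) : MeasurableSpace Ω :=
  ⨆ p ∈ pastCoins n k s, MeasurableSpace.comap (β p.1.1 p.1.2.1 p.1.2.2) inferInstance

theorem measurable_pastSigma {n : ℕ} {β : ℕ → ℕ → ℕ → Ω → ℤ} {k s j i t : ℕ}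
    (h : 1 ≤ i ∧ i ≤ j ∧ j ≤ n ∧ 1 ≤ t)
    (hp : j ≤ k ∨ (j = k + 1 ∧ t ≤ s)) : Measurable[pastSigma n β k s] (β j i t) :=
  Measurable.mono (comap_measurable (β j i t))
    (le_iSup₂_of_le (f := fun (p : CoinIndex n) (_ : p ∈ pastCoins n k s) =>
      MeasurableSpace.comap (β p.1.1 p.1.2.1 p.1.2.2) inferInstance)
      ⟨(j, i, t), h⟩ hp le_rfl) le_rfl

variable [MeasurableSpace Ω] {μ : Measure Ω} [IsProbabilityMeasure μ] {n : ℕ}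
  {β : ℕ → ℕ → ℕ → Ω → ℤ}

theorem IsFairCoins.ae_eq_zero_or_one (hβ : IsFairCoins μ n β) : ∀ᵐ ω ∂μ, ∀ p : CoinIndex n,
    β p.1.1 p.1.2.1 p.1.2.2 ω = 0 ∨ β p.1.1 p.1.2.1 p.1.2.2 ω = 1 := by
  have : Countable (CoinIndex n) := Subtype.countable
  rw [ae_all_iff]
  intro p
  have h0 : MeasurableSet {ω | β p.1.1 p.1.2.1 p.1.2.2 ω = 0} :=
    hβ.measurable p (measurableSet_singleton 0)
  have h1 : MeasurableSet {ω | β p.1.1 p.1.2.1 p.1.2.2 ω = 1} :=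
    hβ.measurable p (measurableSet_singleton 1)
  have h2 : μ ({ω | β p.1.1 p.1.2.1 p.1.2.2 ω = 0} ∪ {ω | β p.1.1 p.1.2.1 p.1.2.2 ω = 1}) = 1 := by
    rw [measure_union (Set.disjoint_left.2 fun ω ha hb => by
      have ha' : β p.1.1 p.1.2.1 p.1.2.2 ω = 0 := ha
      have hb' : β p.1.1 p.1.2.1 p.1.2.2 ω = 1 := hb
      omega) h1, hβ.prob_zero, hβ.prob_one, ENNReal.add_halves]
  exact (prob_compl_eq_zero_iff (h0.union h1)).2 h2

theorem IsFairCoins.measureReal_mem (hβ : IsFairCoins μ n β) (p : CoinIndex n) (B : Set ℤ)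
    [DecidablePred (· ∈ B)] : μ.real {ω | β p.1.1 p.1.2.1 p.1.2.2 ω ∈ B} =
      ∑ e ∈ ({0, 1} : Finset ℤ), if e ∈ B then (1 / 2 : ℝ) else 0 := by
  rw [measureReal_eq_sum_fiber (hβ.measurable p) ({0, 1} : Finset ℤ)]
  · have hhalf : ∀ e ∈ ({0, 1} : Finset ℤ),
        μ.real {ω | β p.1.1 p.1.2.1 p.1.2.2 ω = e} = 1 / 2 := by
      intro e he
      rcases Finset.mem_insert.1 he with rfl | he
      · simp [measureReal_def, hβ.prob_zero]
      · rw [Finset.mem_singleton.1 he]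
        simp [measureReal_def, hβ.prob_one]
    refine Finset.sum_congr rfl fun e he => ?_
    split_ifs with heB
    · rw [← hhalf e he]
      congr 1
      ext ω
      refine ⟨fun h => h.2, fun h => ⟨?_, h⟩⟩
      rw [Set.mem_ofPred_eq, show β _ _ _ ω = e from h]
      exact heB
    · rw [show {ω | β p.1.1 p.1.2.1 p.1.2.2 ω ∈ B} ∩ {ω | β p.1.1 p.1.2.1 p.1.2.2 ω = e} = ∅ from
        Set.eq_empty_of_forall_notMem fun ω h => heB (by
          have h1 : β p.1.1 p.1.2.1 p.1.2.2 ω ∈ B := h.1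
          rwa [show β p.1.1 p.1.2.1 p.1.2.2 ω = e from h.2] at h1)]
      simp
  · filter_upwards [hβ.ae_eq_zero_or_one] with ω hω _
    simpa using hω p

/-- The coins of line `k + 1` at time `s + 1` are independent of `pastSigma` and of each other. -/
theorem IsFairCoins.measureReal_inter_next (hβ : IsFairCoins μ n β) {k s : ℕ} (hk : k + 1 ≤ n)
    {E : Set Ω} (hE : MeasurableSet[pastSigma n β k s] E) (B : Fin (k + 1) → Set ℤ)
    [∀ i, DecidablePred (· ∈ B i)] :
    μ.real (E ∩ {ω | ∀ i, β (k + 1) (i + 1) (s + 1) ω ∈ B i}) = μ.real E *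
      ∏ i, ∑ e ∈ ({0, 1} : Finset ℤ), if e ∈ B i then (1 / 2 : ℝ) else 0 := by
  set g : Fin (k + 1) → CoinIndex n := fun i => ⟨(k + 1, i + 1, s + 1), by simp; omega⟩ with hg
  have hginj : Function.Injective g := fun a b hab => by
    have := congrArg (fun p : CoinIndex n => p.1.2.1) hab
    exact Fin.ext (by simpa [hg] using this)
  have hdisj : Disjoint (pastCoins n k s) (Set.range g) := by
    rw [Set.disjoint_right]
    rintro _ ⟨i, rfl⟩ (h | h)
    · simp [hg] at h
    · simp [hg] at h
  have hind := indep_iSup_of_disjoint (fun p => (hβ.measurable p).comap_le)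
    hβ.indep.iIndep hdisj
  have hF : MeasurableSet[⨆ p ∈ Set.range g, MeasurableSpace.comap (β p.1.1 p.1.2.1 p.1.2.2)
      inferInstance] {ω | ∀ i, β (k + 1) (i + 1) (s + 1) ω ∈ B i} := by
    rw [Set.ofPred_forall]
    refine MeasurableSet.iInter fun i => ?_
    have : MeasurableSpace.comap (β (k + 1) (i + 1) (s + 1)) inferInstance ≤
        ⨆ p ∈ Set.range g, MeasurableSpace.comap (β p.1.1 p.1.2.1 p.1.2.2) inferInstance :=
      le_iSup₂_of_le (f := fun (p : CoinIndex n) (_ : p ∈ Set.range g) =>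
        MeasurableSpace.comap (β p.1.1 p.1.2.1 p.1.2.2) inferInstance) (g i) ⟨i, rfl⟩ le_rfl
    exact this _ ⟨B i, (B i).to_countable.measurableSet, rfl⟩
  have h1 := (Indep_iff _ _ μ).1 hind _ _ hE hF
  have h2 := (hβ.indep.precomp hginj).meas_iInter
    (s := fun i => {ω | β (k + 1) (i + 1) (s + 1) ω ∈ B i})
    (fun i => ⟨B i, (B i).to_countable.measurableSet, rfl⟩)
  rw [← Set.ofPred_forall] at h2
  rw [measureReal_def, h1, h2, ENNReal.toReal_mul, ENNReal.toReal_prod, ← measureReal_def]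
  congr 1
  exact Finset.prod_congr rfl fun i _ => hβ.measureReal_mem (g i) (B i)

end Coins

/-! ### Transition probabilities -/

/-- The one-step transition probability of a line of `k` particles: independent walks, killed on
collision and Doob transformed by `h`. -/
def lineStepProb {k : ℕ} (y y' : Fin k → ℤ) : ℝ :=
  h y' / h y * ((if StrictMono y' then 1 else 0) * walkStepProb y y')

/-- The one-step transition probability of a pair of adjacent lines. -/
def pairStepProb {k : ℕ} (z w : State k) : ℝ :=
  lineStepProb z.2 w.2 * longStepProb z.1 w.2 w.1

theorem pairStepProb_eq {k : ℕ} (z w : State k) :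
    pairStepProb z w = h w.2 / h z.2 * killedStep z w := by
  simp only [pairStepProb, lineStepProb, killedStep, mul_assoc]

/-- The configurations that the pair of lines can reach in one step. -/
def successors {k : ℕ} (z : State k) : Finset (State k) :=
  ((tosses k).filter fun c => StrictMono (update z c).2).image (update z)

theorem successors_subset_W {k : ℕ} {z w : State k} (hz : z ∈ W k) (hw : w ∈ successors z) :
    w ∈ W k := by
  obtain ⟨c, hc, rfl⟩ := Finset.mem_image.1 hw
  rw [Finset.mem_filter] at hc
  exact (update_mem_W hz hc.1 hc.2).1

theorem qPlus_zero {k : ℕ} {z w : State k} (hz : z ∈ W k) (hw : w ∈ W k) :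
    qPlus k 0 z w = if z = w then 1 else 0 := by
  rw [qPlus, q_zero hz hw]
  split_ifs with hzw
  · rw [hzw, div_self (h_pos (W.strictMono_short hw)).ne', one_mul]
  · rw [mul_zero]

/-- The backward equation for `q^{k,+}`. -/
theorem qPlus_succ {k : ℕ} (t : ℕ) {z : State k} (hz : z ∈ W k) (z' : State k) :
    qPlus k (t + 1) z z' = ∑ w ∈ successors z, pairStepProb z w * qPlus k t w z' := by
  have h1 : ∀ w ∈ successors z, pairStepProb z w * qPlus k t w z' =
      ∑ c ∈ tosses k with StrictMono (update z c).2, if update z c = w then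
        h z'.2 / h z.2 * ((1 / 2 : ℝ) ^ (2 * k + 1) * q k t w z') else 0 := by
    intro w hw
    have hpos := (h_pos (W.strictMono_short (successors_subset_W hz hw))).ne'
    rw [pairStepProb_eq, killedStep_eq_sum, Finset.mul_sum, Finset.sum_mul]
    refine Finset.sum_congr rfl fun c _ => ?_
    split_ifs
    · rw [qPlus]
      field_simp
    · simp
  rw [Finset.sum_congr rfl h1, Finset.sum_comm, qPlus, q_succ t z z' (W.strictMono_short hz),
    Finset.mul_sum]
  refine Finset.sum_congr rfl fun c hc => ?_
  have hmem : update z c ∈ successors z := Finset.mem_image_of_mem _ hc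
  rw [Finset.sum_ite_eq, if_pos hmem]

/-! ### The law of two adjacent lines -/

section AdjacentLines

theorem measureReal_eq_zero_of_ae_notMem [MeasurableSpace Ω] {μ : Measure Ω} {E : Set Ω}
    (hE : ∀ᵐ ω ∂μ, ω ∉ E) : μ.real E = 0 := by
  rw [measureReal_def, measure_eq_zero_iff_ae_notMem.2 hE, ENNReal.toReal_zero]

theorem IsFairCoins.measurable_line [MeasurableSpace Ω] {μ : Measure Ω} {n : ℕ}
    {β : ℕ → ℕ → ℕ → Ω → ℤ} (hβ : IsFairCoins μ n β) {k : ℕ} (hk : k ≤ n) (t : ℕ) :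
    Measurable (line β k t) :=
  AztecShuffle.measurable_line
    (fun j i t a b c d => hβ.measurable ⟨(j, i, t), a, b, c.trans hk, d⟩) t

theorem IsFairCoins.measurable_pair [MeasurableSpace Ω] {μ : Measure Ω} {n : ℕ}
    {β : ℕ → ℕ → ℕ → Ω → ℤ} (hβ : IsFairCoins μ n β) {k : ℕ} (hk : k + 1 ≤ n) (t : ℕ) :
    Measurable (pair β k t) :=
  (hβ.measurable_line hk t).prodMk (hβ.measurable_line (by omega) t)

theorem measurableSet_past {_ : MeasurableSpace Ω} {α : Type*} [MeasurableSpace α]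
    [MeasurableSingletonClass α] {Y : ℕ → Ω → α} {s : ℕ} (hY : ∀ r ≤ s, Measurable (Y r))
    (p : ℕ → α) : MeasurableSet {ω | ∀ r ≤ s, Y r ω = p r} := by
  simp only [Set.ofPred_forall]
  exact MeasurableSet.iInter fun r => MeasurableSet.iInter fun hr =>
    hY r hr (measurableSet_singleton _)

variable [MeasurableSpace Ω] {μ : Measure Ω} [IsProbabilityMeasure μ] {n : ℕ}
  {β : ℕ → ℕ → ℕ → Ω → ℤ}

theorem IsFairCoins.ae_pair_mem_W (hβ : IsFairCoins μ n β) {k : ℕ} (hk : k + 1 ≤ n) :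
    ∀ᵐ ω ∂μ, ∀ t, pair β k t ω ∈ W k := by
  filter_upwards [hβ.ae_eq_zero_or_one] with ω hω t
  exact ((line_interlacing_and_step hω (by omega)).2 hk t).1

/-- The law of the path of line `k + 1` given the path of line `k`. The path of line `k` is
prescribed beyond time `s`: this does not influence line `k + 1` up to time `s`, and it is
what the induction on `s` needs. -/
theorem IsFairCoins.long_path_law (hβ : IsFairCoins μ n β) {k : ℕ} (hk : k + 1 ≤ n)
    (x : ℕ → Fin (k + 1) → ℤ) (y : ℕ → Fin k → ℤ) {s T : ℕ} (hsT : s ≤ T) :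
    μ.real {ω | (∀ r ≤ T, line β k r ω = y r) ∧ ∀ r ≤ s, line β (k + 1) r ω = x r} =
      μ.real {ω | ∀ r ≤ T, line β k r ω = y r} * ((if x 0 = start (k + 1) then 1 else 0) *
        ∏ r ∈ Finset.range s, longStepProb (x r) (y (r + 1)) (x (r + 1))) := by
  induction s with
  | zero =>
    simp only [nonpos_iff_eq_zero, forall_eq, line_zero, Finset.range_zero, Finset.prod_empty,
      mul_one]
    split_ifs with h0
    · simp [h0]
    · rw [mul_zero]
      exact measureReal_eq_zero_of_ae_notMem (ae_of_all _ fun ω hω => h0 hω.2.symm)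
  | succ s ih =>
    have hE : MeasurableSet[pastSigma n β k s]
        {ω | (∀ r ≤ T, line β k r ω = y r) ∧ ∀ r ≤ s, line β (k + 1) r ω = x r} := by
      have hm : ∀ t, Measurable[pastSigma n β k s] (line β k t) :=
        @AztecShuffle.measurable_line _ (pastSigma n β k s) β k fun j i t a b c d =>
          measurable_pastSigma ⟨a, b, by omega, d⟩ (Or.inl c)
      have hm' : ∀ t ≤ s, Measurable[pastSigma n β k s] (line β (k + 1) t) :=
        @measurable_line_succ _ (pastSigma n β k s) β k s (fun t _ => hm t) fun i t ht =>
          measurable_pastSigma ⟨by omega, by omega, by omega, by omega⟩ (Or.inr ⟨rfl, ht⟩)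
      exact MeasurableSet.inter (measurableSet_past (fun r _ => hm r) y) (measurableSet_past hm' x)
    have hnext := hβ.measureReal_inter_next hk hE
      (fun i => {e | interact (y (s + 1)) i (x s i + e) = x (s + 1) i})
    have hset : {ω | (∀ r ≤ T, line β k r ω = y r) ∧ ∀ r ≤ s + 1, line β (k + 1) r ω = x r} =
        {ω | (∀ r ≤ T, line β k r ω = y r) ∧ ∀ r ≤ s, line β (k + 1) r ω = x r} ∩
          {ω | ∀ i : Fin (k + 1), β (k + 1) (i + 1) (s + 1) ω ∈
            {e | interact (y (s + 1)) i (x s i + e) = x (s + 1) i}} := by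
      ext ω
      constructor
      · rintro ⟨h1, h2⟩
        refine ⟨⟨h1, fun r hr => h2 r (by omega)⟩, fun i => ?_⟩
        have := line_succ β k s ω i
        rw [h2 (s + 1) le_rfl, h2 s (by omega), h1 (s + 1) hsT] at this
        exact this.symm
      · rintro ⟨⟨h1, h2⟩, h3⟩
        refine ⟨h1, fun r hr => ?_⟩
        rcases Nat.lt_or_ge r (s + 1) with hr' | hr'
        · exact h2 r (by omega)
        · obtain rfl : r = s + 1 := le_antisymm hr hr'
          funext i
          rw [line_succ, h2 s le_rfl, h1 (s + 1) hsT]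
          exact h3 i
    rw [hset, hnext, ih (by omega), Finset.prod_range_succ, mul_assoc, mul_assoc]
    rfl

/-! ### The Markov property of each line -/

/-- Line `k` is a Markov chain with one-step transition probabilities `lineStepProb`. -/
def LineMarkov (μ : Measure Ω) (β : ℕ → ℕ → ℕ → Ω → ℤ) (k : ℕ) : Prop :=
  ∀ (s : ℕ) (y : ℕ → Fin k → ℤ), μ.real {ω | ∀ r ≤ s + 1, line β k r ω = y r} =
    μ.real {ω | ∀ r ≤ s, line β k r ω = y r} * lineStepProb (y s) (y (s + 1))

theorem IsFairCoins.pair_path_succ (hβ : IsFairCoins μ n β) {k : ℕ} (hk : k + 1 ≤ n)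
    (hM : LineMarkov μ β k) (s : ℕ) (z : ℕ → State k) :
    μ.real {ω | ∀ r ≤ s + 1, pair β k r ω = z r} =
      μ.real {ω | ∀ r ≤ s, pair β k r ω = z r} * pairStepProb (z s) (z (s + 1)) := by
  have hset : ∀ s, {ω | ∀ r ≤ s, pair β k r ω = z r} =
      {ω | (∀ r ≤ s, line β k r ω = (z r).2) ∧ ∀ r ≤ s, line β (k + 1) r ω = (z r).1} := by
    intro s
    ext ω
    exact ⟨fun hω => ⟨fun r hr => congrArg Prod.snd (hω r hr),
      fun r hr => congrArg Prod.fst (hω r hr)⟩, fun hω r hr => Prod.ext (hω.2 r hr) (hω.1 r hr)⟩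
  rw [hset, hset, hβ.long_path_law hk (fun r => (z r).1) (fun r => (z r).2) le_rfl,
    hβ.long_path_law hk (fun r => (z r).1) (fun r => (z r).2) le_rfl, hM s fun r => (z r).2,
    Finset.prod_range_succ, pairStepProb]
  ring

/-- A conditional probability given the path up to time `s` that depends on the last position only
is unchanged when the earlier positions are known only partially. -/
theorem IsFairCoins.measureReal_partial_past (hβ : IsFairCoins μ n β) {k : ℕ} (hk : k + 1 ≤ n)
    {s : ℕ} {z : State k} {B : Set Ω} {c : ℝ}
    (hB : ∀ p : ℕ → State k, p s = z →
      μ.real ({ω | ∀ r ≤ s, pair β k r ω = p r} ∩ B) =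
        μ.real {ω | ∀ r ≤ s, pair β k r ω = p r} * c) (A : ℕ → Set (State k)) :
    μ.real ({ω | (∀ r ≤ s, pair β k r ω ∈ A r) ∧ pair β k s ω = z} ∩ B) =
      μ.real {ω | (∀ r ≤ s, pair β k r ω ∈ A r) ∧ pair β k s ω = z} * c := by
  set Y : Ω → Fin (s + 1) → State k := fun ω r => pair β k r ω with hY
  have hYm : Measurable Y := measurable_pi_iff.2 fun r => hβ.measurable_pair hk r
  have hpre : {ω | (∀ r ≤ s, pair β k r ω ∈ A r) ∧ pair β k s ω = z} =
      Y ⁻¹' {a | (∀ r : Fin (s + 1), a r ∈ A r) ∧ a (Fin.last s) = z} := by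
    ext ω
    exact ⟨fun hω => ⟨fun r => hω.1 r (by omega), hω.2⟩,
      fun hω => ⟨fun r hr => hω.1 ⟨r, by omega⟩, hω.2⟩⟩
  rw [hpre]
  refine measureReal_inter_preimage_eq_mul hYm _ fun a ha => ?_
  have hatom : Y ⁻¹' {a} = {ω | ∀ r ≤ s, pair β k r ω =
      if hr : r < s + 1 then a ⟨r, hr⟩ else z} := by
    ext ω
    constructor
    · intro hω r hr
      rw [dif_pos (by omega)]
      exact congrFun hω ⟨r, by omega⟩
    · intro hω
      refine funext fun r => ?_
      have := hω r (by omega)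
      rwa [dif_pos (by omega)] at this
  rw [hatom]
  refine hB _ ?_
  rw [dif_pos (by omega)]
  exact ha.2

/-- The conditional law of line `k` given line `k + 1`: the weights `h_k(y)`, normalized over the
`y` that interlace with `x`. -/
def link {k : ℕ} (x : Fin (k + 1) → ℤ) (y : Fin k → ℤ) : ℝ :=
  if (x, y) ∈ W k then h y / ((∏ j : Fin k, ((j : ℝ) + 1)⁻¹) * h x) else 0

theorem sum_link {k : ℕ} {x : Fin (k + 1) → ℤ} (hx : StrictMono x) :
    ∑ y ∈ interlacing x, link x y = 1 := by
  have h1 : ∏ j : Fin k, ((j : ℝ) + 1)⁻¹ ≠ 0 := (Finset.prod_pos fun j _ => by positivity).ne'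
  have h2 := (h_pos hx).ne'
  have h3 : ∀ y ∈ interlacing x, link x y = h y / ((∏ j : Fin k, ((j : ℝ) + 1)⁻¹) * h x) :=
    fun y hy => if_pos (mem_interlacing.1 hy)
  rw [Finset.sum_congr rfl h3, ← Finset.sum_div, sum_interlacing_h hx, div_self (mul_ne_zero h1 h2)]

/-- The intertwining of two consecutive lines: the link, followed by a step of the pair of lines,
is a step of the longer line followed by the link. -/
theorem sum_link_mul_pairStepProb {k : ℕ} {x : Fin (k + 1) → ℤ} (hx : StrictMono x)
    (x' : Fin (k + 1) → ℤ) (y' : Fin k → ℤ) :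
    ∑ y ∈ predecessors y' with (x, y) ∈ W k, link x y * pairStepProb (x, y) (x', y') =
      lineStepProb x x' * link x' y' := by
  set C := ∏ j : Fin k, ((j : ℝ) + 1)⁻¹ with hC
  have hC0 : C ≠ 0 := (Finset.prod_pos fun j _ => by positivity).ne'
  have hx0 := (h_pos hx).ne'
  by_cases hy' : StrictMono y'
  · have hterm : ∀ y ∈ (predecessors y').filter (fun y => (x, y) ∈ W k),
        link x y * pairStepProb (x, y) (x', y') =
          h y' / (C * h x) * (1 / 2) ^ k * longStepProb x y' x' := by
      intro y hy
      rw [Finset.mem_filter] at hy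
      have hy0 := (h_pos (W.strictMono_short hy.2)).ne'
      simp only at hy0
      rw [link, if_pos hy.2, pairStepProb, lineStepProb, walkStepProb_eq]
      simp only
      rw [if_pos hy', if_pos hy.1, ← hC]
      field_simp
    rw [Finset.sum_congr rfl hterm, ← Finset.mul_sum, sum_longStepProb hx hy', lineStepProb, link,
      walkStepProb_eq, ← hC]
    by_cases hW : (x', y') ∈ W k
    · have hx' : StrictMono x' := W.strictMono_long hW
      have hx0' := (h_pos hx').ne'
      have hiff : ((x', y') ∈ W k ∧ ∀ i, x' i = x i ∨ x' i = x i + 1) ↔ x ∈ predecessors x' := by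
        rw [mem_predecessors]
        exact and_iff_right hW
      rw [if_congr hiff rfl rfl, if_pos hW, if_pos hx']
      split_ifs
      · field_simp
        ring
      · simp
    · rw [if_neg (fun hc => hW hc.1), if_neg hW]
      simp
  · have hW : (x', y') ∉ W k := fun hW => hy' (W.strictMono_short hW)
    rw [link, if_neg hW, mul_zero]
    refine Finset.sum_eq_zero fun y _ => ?_
    rw [pairStepProb, lineStepProb]
    simp only
    rw [if_neg hy']
    simp

theorem link_start {k : ℕ} (y : Fin k → ℤ) :
    link (start (k + 1)) y = if y = start k then 1 else 0 := by
  have hs : StrictMono (start (k + 1)) := fun a b hab => by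
    have := Fin.lt_def.1 hab
    simp only [start]
    omega
  have hiff : ∀ y : Fin k → ℤ, (start (k + 1), y) ∈ W k ↔ y = start k := fun y => by
    constructor
    · intro hW
      funext m
      have := hW m
      simp only [start, Fin.val_castSucc, Fin.val_succ] at this ⊢
      push_cast at this
      omega
    · rintro rfl m
      simp [start]
  split_ifs with hy
  · have h1 := sum_link hs
    rw [show interlacing (start (k + 1)) = {y} from Finset.ext fun a => by
      rw [mem_interlacing, hiff, Finset.mem_singleton, hy], Finset.sum_singleton] at h1
    exact h1
  · rw [link, if_neg (fun hW => hy ((hiff y).1 hW))]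

/-- One step of the Markov function argument: if at time `s` the link describes line `k` given the
past of line `k + 1`, then it does so at time `s + 1`. -/
theorem IsFairCoins.long_path_succ_and_short (hβ : IsFairCoins μ n β) {k : ℕ} (hk : k + 1 ≤ n)
    (hM : LineMarkov μ β k) (s : ℕ) (x : ℕ → Fin (k + 1) → ℤ)
    (hlink : ∀ y, μ.real {ω | (∀ r ≤ s, line β (k + 1) r ω = x r) ∧ line β k s ω = y} =
      μ.real {ω | ∀ r ≤ s, line β (k + 1) r ω = x r} * link (x s) y) (y' : Fin k → ℤ) :
    μ.real {ω | (∀ r ≤ s + 1, line β (k + 1) r ω = x r) ∧ line β k (s + 1) ω = y'} =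
      μ.real {ω | ∀ r ≤ s, line β (k + 1) r ω = x r} * lineStepProb (x s) (x (s + 1)) *
        link (x (s + 1)) y' := by
  by_cases hx : StrictMono (x s)
  · rw [measureReal_eq_sum_fiber (hβ.measurable_line (k := k) (by omega) s)
      ((predecessors y').filter fun y => (x s, y) ∈ W k), mul_assoc,
      ← sum_link_mul_pairStepProb hx, Finset.mul_sum]
    · refine Finset.sum_congr rfl fun y _ => ?_
      rw [← mul_assoc, ← hlink]
      have h1 := hβ.measureReal_partial_past hk (s := s) (z := (x s, y))
        (B := {ω | pair β k (s + 1) ω = (x (s + 1), y')})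
        (c := pairStepProb (x s, y) (x (s + 1), y')) (fun p hp => by
          have h2 := hβ.pair_path_succ hk hM s (Function.update p (s + 1) (x (s + 1), y'))
          rw [Function.update_self, Function.update_of_ne (by omega), hp] at h2
          have h3 : {ω | ∀ r ≤ s, pair β k r ω =
              Function.update p (s + 1) (x (s + 1), y') r} = {ω | ∀ r ≤ s, pair β k r ω = p r} := by
            ext ω
            exact forall₂_congr fun r hr => by rw [Function.update_of_ne (by omega)]
          rw [← h3, ← h2]
          congr 1
          ext ω
          constructor
          · rintro ⟨ha, hb⟩ r hr
            rcases Nat.lt_or_ge r (s + 1) with hr' | hr'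
            · exact ha r (by omega)
            · obtain rfl : r = s + 1 := le_antisymm hr hr'
              rw [Function.update_self]
              exact hb
          · intro ha
            refine ⟨fun r hr => ha r (by omega), ?_⟩
            have := ha (s + 1) le_rfl
            rwa [Function.update_self] at this)
        (fun r => {w | w.1 = x r})
      have h4 : {ω | (∀ r ≤ s, pair β k r ω ∈ {w : State k | w.1 = x r}) ∧
          pair β k s ω = (x s, y)} =
          {ω | (∀ r ≤ s, line β (k + 1) r ω = x r) ∧ line β k s ω = y} := by
        ext ω
        exact ⟨fun hω => ⟨hω.1, congrArg Prod.snd hω.2⟩,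
          fun hω => ⟨hω.1, Prod.ext (hω.1 s le_rfl) hω.2⟩⟩
      rw [h4] at h1
      rw [← h1]
      congr 1
      ext ω
      constructor
      · rintro ⟨⟨ha, hb⟩, hc⟩
        exact ⟨⟨fun r hr => ha r (by omega), hc⟩, Prod.ext (ha _ le_rfl) hb⟩
      · rintro ⟨⟨ha, hc⟩, hb⟩
        refine ⟨⟨fun r hr => ?_, congrArg Prod.snd hb⟩, hc⟩
        rcases Nat.lt_or_ge r (s + 1) with hr' | hr'
        · exact ha r (by omega)
        · obtain rfl : r = s + 1 := le_antisymm hr hr'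
          exact congrArg Prod.fst hb
    · filter_upwards [hβ.ae_eq_zero_or_one] with ω hω hE
      obtain ⟨h1, h2⟩ := line_interlacing_and_step hω (show k ≤ n by omega)
      rw [Finset.mem_filter]
      refine ⟨?_, ?_⟩
      · rw [← hE.2]
        exact (h1 s).2
      · have := (h2 hk s).1
        rwa [pair_eq, hE.1 s (by omega)] at this
  · have hzero : ∀ᵐ ω ∂μ, line β (k + 1) s ω ≠ x s := by
      filter_upwards [hβ.ae_eq_zero_or_one] with ω hω heq
      exact hx (heq ▸ ((line_interlacing_and_step hω hk).1 s).1)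
    rw [measureReal_eq_zero_of_ae_notMem (E := {ω | ∀ r ≤ s, line β (k + 1) r ω = x r}),
      measureReal_eq_zero_of_ae_notMem]
    · simp
    · filter_upwards [hzero] with ω h1 h2
      exact h1 (h2.1 s (by omega))
    · filter_upwards [hzero] with ω h1 h2
      exact h1 (h2 s le_rfl)

theorem IsFairCoins.long_path_succ (hβ : IsFairCoins μ n β) {k : ℕ} (hk : k + 1 ≤ n)
    (hM : LineMarkov μ β k) (s : ℕ) (x : ℕ → Fin (k + 1) → ℤ)
    (hlink : ∀ y, μ.real {ω | (∀ r ≤ s, line β (k + 1) r ω = x r) ∧ line β k s ω = y} =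
      μ.real {ω | ∀ r ≤ s, line β (k + 1) r ω = x r} * link (x s) y) :
    μ.real {ω | ∀ r ≤ s + 1, line β (k + 1) r ω = x r} =
      μ.real {ω | ∀ r ≤ s, line β (k + 1) r ω = x r} * lineStepProb (x s) (x (s + 1)) := by
  have h1 : μ.real {ω | ∀ r ≤ s + 1, line β (k + 1) r ω = x r} =
      ∑ y ∈ interlacing (x (s + 1)), μ.real {ω | (∀ r ≤ s + 1, line β (k + 1) r ω = x r) ∧
        line β k (s + 1) ω = y} := by
    refine measureReal_eq_sum_fiber (hβ.measurable_line (by omega) _) _ ?_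
    filter_upwards [hβ.ae_pair_mem_W hk] with ω hω hE
    rw [mem_interlacing, ← hE (s + 1) le_rfl]
    exact hω (s + 1)
  rw [h1, Finset.sum_congr rfl fun y _ => hβ.long_path_succ_and_short hk hM s x hlink y,
    ← Finset.mul_sum]
  by_cases hx : StrictMono (x (s + 1))
  · rw [sum_link hx, mul_one]
  · rw [lineStepProb, if_neg hx]
    simp

/-- Given the past of line `k + 1`, the law of line `k` depends on the current position of line
`k + 1` only, and is given by the link. -/
theorem IsFairCoins.link_law (hβ : IsFairCoins μ n β) {k : ℕ} (hk : k + 1 ≤ n)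
    (hM : LineMarkov μ β k) (s : ℕ) (x : ℕ → Fin (k + 1) → ℤ) (y : Fin k → ℤ) :
    μ.real {ω | (∀ r ≤ s, line β (k + 1) r ω = x r) ∧ line β k s ω = y} =
      μ.real {ω | ∀ r ≤ s, line β (k + 1) r ω = x r} * link (x s) y := by
  induction s generalizing y with
  | zero =>
    simp only [nonpos_iff_eq_zero, forall_eq, line_zero]
    by_cases hx : start (k + 1) = x 0
    · rw [← hx, link_start]
      by_cases hy : y = start k
      · simp [hy]
      · simp [hy, Ne.symm hy]
    · simp [hx]
  | succ s ih =>
    rw [hβ.long_path_succ_and_short hk hM s x ih, hβ.long_path_succ hk hM s x ih]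

theorem IsFairCoins.lineMarkov (hβ : IsFairCoins μ n β) {k : ℕ} (hk : k ≤ n) :
    LineMarkov μ β k := by
  induction k with
  | zero =>
    intro s y
    have h1 : ∀ s, {ω | ∀ r ≤ s, line β 0 r ω = y r} = Set.univ := fun s =>
      Set.eq_univ_of_forall fun ω r _ => Subsingleton.elim _ _
    have h2 : StrictMono (y (s + 1)) := fun a => a.elim0
    rw [h1, h1, lineStepProb, if_pos h2]
    simp [h, walkStepProb]
  | succ k ih =>
    intro s x
    exact hβ.long_path_succ hk (ih (by omega)) s x fun y => hβ.link_law hk (ih (by omega)) s x y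

/-! ### The Markov property of the pair of lines -/

/-- The Markov property of the pair of lines with the `t`-step transition probabilities
`q_t^{k,+}`. -/
theorem IsFairCoins.pair_markov (hβ : IsFairCoins μ n β) {k : ℕ} (hk : k + 1 ≤ n) (t : ℕ)
    {s : ℕ} (p : ℕ → State k) {z' : State k} (hp : p s ∈ W k) (hz' : z' ∈ W k) :
    μ.real ({ω | ∀ r ≤ s, pair β k r ω = p r} ∩ {ω | pair β k (s + t) ω = z'}) =
      μ.real {ω | ∀ r ≤ s, pair β k r ω = p r} * qPlus k t (p s) z' := by
  induction t generalizing s p with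
  | zero =>
    rw [qPlus_zero hp hz', add_zero]
    split_ifs with h0
    · rw [mul_one]
      congr 1
      ext ω
      exact ⟨fun hω => hω.1, fun hω => ⟨hω, (hω s le_rfl).trans h0⟩⟩
    · rw [mul_zero]
      exact measureReal_eq_zero_of_ae_notMem (ae_of_all _ fun ω hω =>
        h0 ((hω.1 s le_rfl).symm.trans hω.2))
  | succ t ih =>
    rw [measureReal_eq_sum_fiber (hβ.measurable_pair hk (s + 1)) (successors (p s)),
      qPlus_succ t hp, Finset.mul_sum]
    · refine Finset.sum_congr rfl fun w hw => ?_
      have h1 := ih (s := s + 1) (Function.update p (s + 1) w) (by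
        rw [Function.update_self]
        exact successors_subset_W hp hw)
      have h2 := hβ.pair_path_succ hk (hβ.lineMarkov (by omega)) s (Function.update p (s + 1) w)
      have h3 : {ω | ∀ r ≤ s, pair β k r ω = Function.update p (s + 1) w r} =
          {ω | ∀ r ≤ s, pair β k r ω = p r} := by
        ext ω
        exact forall₂_congr fun r hr => by rw [Function.update_of_ne (by omega)]
      rw [h3, Function.update_self, Function.update_of_ne (by omega)] at h2
      rw [h2, Function.update_self, mul_assoc, show s + 1 + t = s + (t + 1) by omega] at h1
      rw [← h1]
      congr 1
      ext ω
      constructor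
      · rintro ⟨⟨ha, hb⟩, hc⟩
        refine ⟨fun r hr => ?_, hb⟩
        rcases Nat.lt_or_ge r (s + 1) with hr' | hr'
        · rw [Function.update_of_ne (by omega)]
          exact ha r (by omega)
        · obtain rfl : r = s + 1 := le_antisymm hr hr'
          rw [Function.update_self]
          exact hc
      · rintro ⟨ha, hb⟩
        refine ⟨⟨fun r hr => ?_, hb⟩, ?_⟩
        · have := ha r (by omega)
          rwa [Function.update_of_ne (by omega)] at this
        · have := ha (s + 1) le_rfl
          rwa [Function.update_self] at this
    · filter_upwards [hβ.ae_eq_zero_or_one] with ω hω hE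
      obtain ⟨h1, h2⟩ := line_interlacing_and_step hω (show k ≤ n by omega)
      rw [← hE.1 s le_rfl, pair_succ]
      refine Finset.mem_image_of_mem _ (Finset.mem_filter.2 ⟨(h2 hk s).2, ?_⟩)
      rw [← pair_succ]
      exact (h1 (s + 1)).1

end AdjacentLines

end AztecShuffle

end

theorem mainTheorem1 {Ω : Type*} [MeasurableSpace Ω] (μ : MeasureTheory.Measure Ω)
    [MeasureTheory.IsProbabilityMeasure μ] (n : ℕ) (β : ℕ → ℕ → ℕ → Ω → ℤ)
    (hβ : AztecShuffle.IsFairCoins μ n β) (k : ℕ) (hk : 1 ≤ k) (hkn : k < n) :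
    (∀ᵐ ω ∂μ, ∀ t : ℕ, AztecShuffle.pair β k t ω ∈ AztecShuffle.W k) ∧
    (∀ (s t : ℕ) (z z' : AztecShuffle.State k),
      z ∈ AztecShuffle.W k → z' ∈ AztecShuffle.W k →
      μ {ω | AztecShuffle.pair β k s ω = z} ≠ 0 →
      (ProbabilityTheory.cond μ {ω | AztecShuffle.pair β k s ω = z}).real
          {ω | AztecShuffle.pair β k (s + t) ω = z'}
        = AztecShuffle.qPlus k t z z') ∧
    (∀ (s t : ℕ) (z : ℕ → AztecShuffle.State k) (z' : AztecShuffle.State k),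
      (∀ r ≤ s, z r ∈ AztecShuffle.W k) → z' ∈ AztecShuffle.W k →
      μ {ω | ∀ r ≤ s, AztecShuffle.pair β k r ω = z r} ≠ 0 →
      (ProbabilityTheory.cond μ {ω | ∀ r ≤ s, AztecShuffle.pair β k r ω = z r}).real
          {ω | AztecShuffle.pair β k (s + t) ω = z'}
        = AztecShuffle.qPlus k t (z s) z') := by
  have hcond : ∀ (E B : Set Ω) (c : ℝ), MeasurableSet E → μ E ≠ 0 →
      μ.real (E ∩ B) = μ.real E * c → (ProbabilityTheory.cond μ E).real B = c := by
    intro E B c hE h0 h1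
    have h2 : μ.real E ≠ 0 := (ENNReal.toReal_ne_zero).2 ⟨h0, MeasureTheory.measure_ne_top _ _⟩
    rw [MeasureTheory.measureReal_def, ProbabilityTheory.cond_apply hE, ENNReal.toReal_mul,
      ENNReal.toReal_inv, ← MeasureTheory.measureReal_def, ← MeasureTheory.measureReal_def, h1,
      inv_mul_cancel_left₀ h2]
  refine ⟨hβ.ae_pair_mem_W hkn, fun s t z z' hz hz' h0 => ?_, fun s t z z' hz hz' h0 => ?_⟩
  · refine hcond _ _ _ (hβ.measurable_pair hkn s (MeasurableSet.singleton z)) h0 ?_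
    have h1 := hβ.measureReal_partial_past hkn (s := s) (z := z)
      (B := {ω | AztecShuffle.pair β k (s + t) ω = z'}) (c := AztecShuffle.qPlus k t z z')
      (fun p hp => hp ▸ hβ.pair_markov hkn t p (hp ▸ hz) hz') (fun _ => Set.univ)
    simpa using h1
  · exact hcond _ _ _ (AztecShuffle.measurableSet_past (fun r _ => hβ.measurable_pair hkn r) z) h0
      (hβ.pair_markov hkn t z (hz s le_rfl) hz')
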